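/- Let $d\ge 1$ be an integer and $q=e^{2\pi i/d}$. For a finite or countably infinite number $m$ of generators, the parafermion algebra $PF_m$ of order $d$ is the unital complex $*$-algebra generated by $c_1,c_2,\dots$ ($m$ generators) with relations $$c_jc_k=q\,c_kc_j\ \ (j<k),\qquad c_j^d=1,\qquad c_j^*=c_j^{-1}.$$ It is $\mathbb Z_d$-graded by $\deg c_j=1$ (the degree is also called charge), and $PF_2\cong M_d(\mathbb C)$. A state on a unital $*$-algebra is a linear functional $\varphi$ with $\varphi(1)=1$ and $\varphi(x^*x)\ge 0$ for all $x$. A density matrix of a state $\rho$ on $PF_2$ is the element $D\in PF_2$ with $\rho(x)=\operatorname{Tr}(Dx)$ for all $x \in PF_2\cong M_d(\mathbb C)$. For $k\ge1$ let $b^{(2)}_k=\frac1{\sqrt d}\sum_{i=0}^{d-1}c_k^{\,i}c_{k+1}^{-i}$ (a unitary; multiplying it by a phase changes nothing below), let $$b_j=b^{(2)}_{2j}\,b^{(2)}_{2j-1}\,b^{(2)}_{2j+1}\,b^{(2)}_{2j}\qquad(j\ge 1)$$ be the four-string braid, which exchanges the pairs $(c_{2j-1},c_{2j})$ and $(c_{2j+1},c_{2j+2})$,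 and let $\mathbb B_\infty$ be the group of unitaries of $PF_\infty$ generated by all $b_j$. Let $S_{\mathbb B_\infty}$ be the convex set of states $\varphi$ on $PF_\infty$ with $\varphi(bxb^*)=\varphi(x)$ for all $b\in\mathbb B_\infty$, $x\in PF_\infty$. For a state $\rho$ on $PF_2$, we write $\varphi=\rho^{\otimes\infty}$ if for all $n$ and all $x_1,\dots,x_n\in PF_2$ $$\varphi\bigl(\iota_1(x_1)\iota_2(x_2)\cdots\iota_n(x_n)\bigr)=\rho(x_1)\rho(x_2)\cdots\rho(x_n),$$ where $\iota_k:PF_2\to PF_\infty$ is the homomorphism $c_1\mapsto c_{2k-1}$, $c_2\mapsto c_{2k}$. Finally let $p_0$ be the least positive integer with $d\mid p_0^2$. **Theorem.** Let $\varphi\in S_{\mathbb B_\infty}$. Then the following are equivalent: 1. $\varphi$ is an extreme point of $S_{\mathbb B_\infty}$; 2. $\varphi=\rho^{\otimes\infty}$ for some state $\rho$ on $PF_2$ whose density matrix is a sum of elements of $PF_2$ with charges in $p_0\mathbb Z/d\mathbb Z$; 3. $\varphi=\rho^{\otimes\infty}$ for some state $\rho$ on $PF_2$. -/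

import Mathlib

/-! # Parafermion algebras, double braids, and braid-invariant states -/

noncomputable section

namespace Parafermion

/-- The primitive `d`-th root of unity `q = exp (2πi/d)`. -/
def q (d : ℕ) : ℂ := Complex.exp (2 * Real.pi * Complex.I / d)

theorem q_pow (d : ℕ) [NeZero d] : q d ^ d = 1 := by
  rw [q, ← Complex.exp_nat_mul, mul_div_cancel₀]
  · exact Complex.exp_two_pi_mul_I
  · exact_mod_cast NeZero.ne d

theorem conj_q_mul (d : ℕ) : (starRingEnd ℂ) (q d) * q d = 1 := by
  rw [q, ← Complex.exp_conj, ← Complex.exp_add, ← Complex.exp_zero]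
  congr 1
  simp [map_div₀, map_ofNat]
  ring

/-- The canonical parafermion relations `c_j c_k = q c_k c_j` for `j < k` and `c_j ^ d = 1`. -/
inductive Rel (d : ℕ) (ι : Type*) [LinearOrder ι] :
    FreeAlgebra ℂ ι → FreeAlgebra ℂ ι → Prop
  | comm {j k : ι} (h : j < k) :
      Rel d ι (FreeAlgebra.ι ℂ j * FreeAlgebra.ι ℂ k)
        (q d • (FreeAlgebra.ι ℂ k * FreeAlgebra.ι ℂ j))
  | pow (j : ι) : Rel d ι (FreeAlgebra.ι ℂ j ^ d) 1

/-- The parafermion algebra of order `d` with generators indexed by the linear order `ι`: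
the unital complex algebra presented by the canonical parafermion relations.
`PF d ℕ` is `PF_∞`, and `PF d (Fin m)` is `PF_m`. -/
def PF (d : ℕ) (ι : Type*) [LinearOrder ι] : Type _ := RingQuot (Rel d ι)

section Basic

variable {d : ℕ} {ι : Type*} [LinearOrder ι]

instance : Ring (PF d ι) := inferInstanceAs (Ring (RingQuot (Rel d ι)))

instance : Algebra ℂ (PF d ι) := inferInstanceAs (Algebra ℂ (RingQuot (Rel d ι)))

/-- The parafermion generators. -/
def c (j : ι) : PF d ι := RingQuot.mkAlgHom ℂ (Rel d ι) (FreeAlgebra.ι ℂ j)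

theorem c_comm {j k : ι} (h : j < k) : (c j * c k : PF d ι) = q d • (c k * c j) := by
  have := RingQuot.mkAlgHom_rel ℂ (Rel.comm (d := d) h)
  rw [map_mul, map_smul, map_mul] at this
  exact this

theorem c_pow (j : ι) : (c j ^ d : PF d ι) = 1 := by
  have := RingQuot.mkAlgHom_rel ℂ (Rel.pow (d := d) j)
  rw [map_pow, map_one] at this
  exact this

theorem induction {P : PF d ι → Prop} (h0 : ∀ r : ℂ, P (algebraMap ℂ _ r))
    (h1 : ∀ j, P (c j)) (hm : ∀ x y, P x → P y → P (x * y))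
    (ha : ∀ x y, P x → P y → P (x + y)) (x : PF d ι) : P x := by
  obtain ⟨a, rfl⟩ := RingQuot.mkAlgHom_surjective ℂ (Rel d ι) x
  induction a using FreeAlgebra.induction with
  | grade0 r => rw [AlgHom.commutes]; exact h0 r
  | grade1 j => exact h1 j
  | mul a b ha hb => rw [map_mul]; exact hm _ _ ha hb
  | add a b h h' => rw [map_add]; exact ha _ _ h h'

/-- The universal property of the parafermion algebra. -/
def lift {A : Type*} [Ring A] [Algebra ℂ A] (f : ι → A)
    (hc : ∀ j k, j < k → f j * f k = q d • (f k * f j)) (hp : ∀ j, f j ^ d = 1) :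
    PF d ι →ₐ[ℂ] A :=
  RingQuot.liftAlgHom ℂ ⟨FreeAlgebra.lift ℂ f, by
    rintro _ _ (⟨h⟩ | ⟨j⟩)
    · simpa using hc _ _ h
    · simpa using hp j⟩

theorem lift_c {A : Type*} [Ring A] [Algebra ℂ A] (f : ι → A)
    (hc : ∀ j k, j < k → f j * f k = q d • (f k * f j)) (hp : ∀ j, f j ^ d = 1) (j : ι) :
    lift f hc hp (c j : PF d ι) = f j := by
  unfold lift c
  refine (RingQuot.liftAlgHom_mkAlgHom_apply ℂ _ _ _).trans ?_
  simp

end Basic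

section Star

variable {d : ℕ} [NeZero d] {ι : Type*} [LinearOrder ι]

theorem c_mul_pow_pred (j : ι) : (c j * c j ^ (d - 1) : PF d ι) = 1 := by
  rw [← pow_succ', Nat.sub_add_cancel (Nat.one_le_iff_ne_zero.2 (NeZero.ne d)), c_pow]

theorem pow_pred_mul_c (j : ι) : (c j ^ (d - 1) * c j : PF d ι) = 1 := by
  rw [← pow_succ, Nat.sub_add_cancel (Nat.one_le_iff_ne_zero.2 (NeZero.ne d)), c_pow]

theorem pow_pred_comm {j k : ι} (h : j < k) :
    (c j ^ (d - 1) * c k ^ (d - 1) : PF d ι) = q d • (c k ^ (d - 1) * c j ^ (d - 1)) := by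
  set a : PF d ι := c j ^ (d - 1) with ha
  set b : PF d ι := c k ^ (d - 1) with hb
  have h1 : a * c j = 1 := pow_pred_mul_c j
  have h1' : c j * a = 1 := c_mul_pow_pred j
  have h2 : b * c k = 1 := pow_pred_mul_c k
  have h2' : c k * b = 1 := c_mul_pow_pred k
  have e : (c j * c k : PF d ι) = q d • (c k * c j) := c_comm h
  have e1 : (a * b) * (c j * c k) = q d • 1 := by
    rw [e, mul_smul_comm]
    congr 1
    calc a * b * (c k * c j) = a * (b * c k) * c j := by simp only [mul_assoc]
      _ = 1 := by rw [h2, mul_one, h1]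
  have e2 : (c j * c k) * (b * a) = 1 := by
    calc (c j * c k) * (b * a) = c j * (c k * b) * a := by simp only [mul_assoc]
      _ = 1 := by rw [h2', mul_one, h1']
  calc a * b = a * b * ((c j * c k) * (b * a)) := by rw [e2, mul_one]
    _ = q d • (b * a) := by rw [← mul_assoc, e1, smul_mul_assoc, one_mul]

/-- The adjoint as a ring homomorphism into the opposite algebra: it is conjugate linear and
sends each generator to its inverse `c_j ^ (d - 1)`. -/
def starHom (d : ℕ) [NeZero d] (ι : Type*) [LinearOrder ι] : PF d ι →+* (PF d ι)ᵐᵒᵖ :=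
  @AlgHom.toRingHom ℂ _ _ _ _ _ _ (Algebra.compHom (PF d ι)ᵐᵒᵖ (starRingEnd ℂ))
   (@lift d ι _ (PF d ι)ᵐᵒᵖ _ (Algebra.compHom (PF d ι)ᵐᵒᵖ (starRingEnd ℂ))
    (fun j => MulOpposite.op (c j ^ (d - 1)))
    (fun j k h => by
      rw [← MulOpposite.op_mul, ← MulOpposite.op_mul, pow_pred_comm h]
      change MulOpposite.op (c k ^ (d - 1) * c j ^ (d - 1)) =
        (starRingEnd ℂ (q d)) • MulOpposite.op (q d • (c k ^ (d - 1) * c j ^ (d - 1)))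
      rw [MulOpposite.op_smul, smul_smul, conj_q_mul, one_smul])
    (fun j => by
      rw [← MulOpposite.op_pow, ← pow_mul, mul_comm, pow_mul, c_pow, one_pow,
        MulOpposite.op_one]))

theorem starHom_c (j : ι) : starHom d ι (c j) = MulOpposite.op (c j ^ (d - 1)) :=
  @lift_c d ι _ (PF d ι)ᵐᵒᵖ _ (Algebra.compHom (PF d ι)ᵐᵒᵖ (starRingEnd ℂ)) _ _ _ j

theorem starHom_algebraMap (r : ℂ) : starHom d ι (algebraMap ℂ _ r) =
    MulOpposite.op (algebraMap ℂ _ (starRingEnd ℂ r)) :=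
  @AlgHom.commutes ℂ (PF d ι) (PF d ι)ᵐᵒᵖ _ _ _ _
    (Algebra.compHom (PF d ι)ᵐᵒᵖ (starRingEnd ℂ)) _ r

instance : Star (PF d ι) := ⟨fun x => (starHom d ι x).unop⟩

theorem star_def (x : PF d ι) : star x = (starHom d ι x).unop := rfl

/-- `c_j^* = c_j⁻¹`. -/
theorem star_c (j : ι) : star (c j : PF d ι) = c j ^ (d - 1) := by
  rw [star_def, starHom_c, MulOpposite.unop_op]

theorem star_algebraMap (r : ℂ) :
    star (algebraMap ℂ (PF d ι) r) = algebraMap ℂ _ (starRingEnd ℂ r) := by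
  rw [star_def, starHom_algebraMap, MulOpposite.unop_op]

theorem star_mul_aux (x y : PF d ι) : star (x * y) = star y * star x := by
  rw [star_def, map_mul, MulOpposite.unop_mul]; rfl

theorem star_pow_aux (x : PF d ι) (n : ℕ) : star (x ^ n) = star x ^ n := by
  rw [star_def, map_pow, MulOpposite.unop_pow]; rfl

theorem star_add_aux (x y : PF d ι) : star (x + y) = star x + star y := by
  rw [star_def, map_add, MulOpposite.unop_add]; rfl

instance : StarRing (PF d ι) where
  star_involutive := by
    intro x
    induction x using induction with
    | h0 r => rw [star_algebraMap, star_algebraMap, Complex.conj_conj]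
    | h1 j =>
      rw [star_c, star_pow_aux, star_c]
      calc ((c j ^ (d - 1)) ^ (d - 1) : PF d ι)
          = (c j ^ (d - 1)) ^ (d - 1) * (c j ^ (d - 1) * c j) := by
            rw [pow_pred_mul_c, mul_one]
        _ = (c j ^ (d - 1)) ^ (d - 1 + 1) * c j := by rw [pow_succ, mul_assoc]
        _ = c j := by
            rw [Nat.sub_add_cancel (Nat.one_le_iff_ne_zero.2 (NeZero.ne d)), ← pow_mul,
              mul_comm, pow_mul, c_pow, one_pow, one_mul]
    | hm x y hx hy => rw [star_mul_aux, star_mul_aux, hx, hy]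
    | ha x y hx hy => rw [star_add_aux, star_add_aux, hx, hy]
  star_mul := star_mul_aux
  star_add := star_add_aux

instance : StarModule ℂ (PF d ι) where
  star_smul r x := by
    rw [Algebra.smul_def, star_mul, star_algebraMap, Algebra.smul_def,
      Algebra.commutes]
    rfl

theorem star_c_mul (j : ι) : star (c j : PF d ι) * c j = 1 := by
  rw [star_c, pow_pred_mul_c]

theorem c_mul_star (j : ι) : c j * star (c j : PF d ι) = 1 := by
  rw [star_c, c_mul_pow_pred]

end Star

section Braids

variable {d : ℕ} [NeZero d]

/-- The two-string braid of the strings `k` and `k + 1`,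
`d^{-1/2} ∑_{i=0}^{d-1} c_k^i c_{k+1}^{-i}`, up to a scalar of modulus one, which does not
affect the adjoint action. -/
def twoBraidElt (d : ℕ) [NeZero d] (k : ℕ) : PF d ℕ :=
  ((Real.sqrt d : ℝ) : ℂ)⁻¹ • ∑ i : ZMod d, c k ^ i.val * star (c (k + 1)) ^ i.val

theorem pow_val_add {A : Type*} [Monoid A] {u : A} (hu : u ^ d = 1) (i j : ZMod d) :
    u ^ (i + j).val = u ^ i.val * u ^ j.val := by
  rw [ZMod.val_add, ← pow_add]
  conv_rhs => rw [← Nat.mod_add_div (i.val + j.val) d, pow_add, pow_mul, hu, one_pow, mul_one]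

theorem star_pow_val {A : Type*} [Ring A] [StarRing A] {u : A} (hu : u ^ d = 1)
    (hu1 : star u * u = 1) (i : ZMod d) : star (u ^ i.val) = u ^ (-i).val := by
  have h1 : star (u ^ i.val) * u ^ i.val = 1 := by
    rw [star_pow]
    have : ∀ n : ℕ, star u ^ n * u ^ n = 1 := by
      intro n
      induction n with
      | zero => simp
      | succ n ih =>
        rw [pow_succ, pow_succ', mul_assoc, ← mul_assoc (star u) u, hu1, one_mul, ih]
    exact this _
  have h2 : u ^ i.val * u ^ (-i).val = 1 := by
    rw [← pow_val_add hu, add_neg_cancel, ZMod.val_zero, pow_zero]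
  calc star (u ^ i.val) = star (u ^ i.val) * (u ^ i.val * u ^ (-i).val) := by rw [h2, mul_one]
    _ = _ := by rw [← mul_assoc, h1, one_mul]

theorem pow_comm_aux {A : Type*} [Ring A] [Algebra ℂ A] {u v : A} {z : ℂ}
    (h : v * u = z • (u * v)) (m n : ℕ) : v ^ m * u ^ n = z ^ (m * n) • (u ^ n * v ^ m) := by
  have h1 : ∀ n : ℕ, v * u ^ n = z ^ n • (u ^ n * v) := by
    intro n
    induction n with
    | zero => simp
    | succ n ih =>
      rw [pow_succ, ← mul_assoc, ih, smul_mul_assoc, mul_assoc, h, mul_smul_comm, smul_smul,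
        ← mul_assoc, pow_succ z]
  induction m with
  | zero => simp
  | succ m ih =>
    rw [pow_succ', mul_assoc, ih, mul_smul_comm, ← mul_assoc, h1, smul_mul_assoc, smul_smul,
      mul_assoc, ← pow_add]
    congr 2
    ring

theorem q_pow_val (i j : ZMod d) : q d ^ (i.val * j.val) = ZMod.stdAddChar (i * j) := by
  have : (i * j) = (((i.val * j.val : ℕ) : ℤ) : ZMod d) := by simp
  rw [this, ZMod.stdAddChar_coe, q, ← Complex.exp_nat_mul]
  congr 1
  push_cast
  ring

theorem sum_unitary {A : Type*} [Ring A] [StarRing A] [Algebra ℂ A] [StarModule ℂ A]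
    {u v : A} (hu : u ^ d = 1) (hv : v ^ d = 1) (hu1 : star u * u = 1) (hv1 : star v * v = 1)
    (h : v * u = q d • (u * v)) :
    (((Real.sqrt d : ℝ) : ℂ)⁻¹ • ∑ i : ZMod d, u ^ i.val * v ^ i.val) ∈ unitary A := by
  have hcomm : ∀ i j : ZMod d, v ^ i.val * u ^ j.val =
      ZMod.stdAddChar (i * j) • (u ^ j.val * v ^ i.val) := by
    intro i j
    rw [pow_comm_aux h, q_pow_val]
  have hstar : star (∑ i : ZMod d, u ^ i.val * v ^ i.val) =
      ∑ i : ZMod d, v ^ (-i).val * u ^ (-i).val := by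
    rw [star_sum]
    refine Finset.sum_congr rfl fun i _ => ?_
    rw [star_mul, star_pow_val hu hu1, star_pow_val hv hv1]
  have hsum : ∑ r : ZMod d, ∑ j : ZMod d,
      (ZMod.stdAddChar (-j * r) : ℂ) • (u ^ r.val * v ^ r.val) = (d : ℂ) • (1 : A) := by
    have : ∀ r : ZMod d, ∑ j : ZMod d, (ZMod.stdAddChar (-j * r) : ℂ) • (u ^ r.val * v ^ r.val)
        = if r = 0 then (d : ℂ) • (1 : A) else 0 := by
      intro r
      rw [← Finset.sum_smul]
      have := AddChar.sum_mulShift (-r) (ZMod.isPrimitive_stdAddChar d)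
      simp only [neg_eq_zero, ZMod.card] at this
      have h2 : ∑ j : ZMod d, (ZMod.stdAddChar (-j * r) : ℂ) =
          ∑ j : ZMod d, ZMod.stdAddChar (j * -r) := by
        refine Finset.sum_congr rfl fun j _ => ?_
        congr 1; ring
      rw [h2, this]
      split_ifs with hr
      · subst hr; simp
      · simp
    rw [Finset.sum_congr rfl fun r _ => this r]
    simp
  have hscal : (((Real.sqrt d : ℝ) : ℂ)⁻¹ * ((Real.sqrt d : ℝ) : ℂ)⁻¹) * (d : ℂ) = 1 := by
    rw [← mul_inv, ← Complex.ofReal_mul, Real.mul_self_sqrt (Nat.cast_nonneg d)]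
    simp [NeZero.ne d]
  have key : ∀ S T : A, S * T = (d : ℂ) • (1 : A) →
      (((Real.sqrt d : ℝ) : ℂ)⁻¹ • S) * (((Real.sqrt d : ℝ) : ℂ)⁻¹ • T) = 1 := by
    intro S T hST
    rw [smul_mul_smul_comm, hST, smul_smul, hscal, one_smul]
  have hstar' : star (((Real.sqrt d : ℝ) : ℂ)⁻¹ • ∑ i : ZMod d, u ^ i.val * v ^ i.val) =
      ((Real.sqrt d : ℝ) : ℂ)⁻¹ • ∑ i : ZMod d, v ^ (-i).val * u ^ (-i).val := by
    rw [star_smul, hstar]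
    simp
  rw [Unitary.mem_iff, hstar']
  constructor
  · apply key
    rw [← hsum, Finset.sum_mul_sum]
    conv_rhs => rw [Finset.sum_comm]
    refine Finset.sum_congr rfl fun j _ => ?_
    refine Fintype.sum_equiv (Equiv.subRight j) _ _ fun i => ?_
    rw [Equiv.subRight_apply]
    have e : v ^ (-j).val * u ^ (-j).val * (u ^ i.val * v ^ i.val) =
        v ^ (-j).val * u ^ (i - j).val * v ^ i.val := by
      rw [sub_eq_neg_add, pow_val_add hu]; simp only [mul_assoc]
    rw [e, hcomm, smul_mul_assoc, mul_assoc, ← pow_val_add hv, sub_eq_neg_add]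
  · apply key
    rw [← hsum, Finset.sum_mul_sum, Finset.sum_comm]
    conv_rhs => rw [Finset.sum_comm]
    refine Finset.sum_congr rfl fun j _ => ?_
    refine Fintype.sum_equiv (Equiv.subRight j) _ _ fun i => ?_
    rw [Equiv.subRight_apply]
    have e : u ^ i.val * v ^ i.val * (v ^ (-j).val * u ^ (-j).val) =
        u ^ i.val * (v ^ (i - j).val * u ^ (-j).val) := by
      rw [sub_eq_add_neg, pow_val_add hv]; simp only [mul_assoc]
    rw [e, hcomm, mul_smul_comm, ← mul_assoc, ← pow_val_add hu, ← sub_eq_add_neg,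
      mul_comm (i - j)]

theorem twoBraidElt_mem (k : ℕ) : twoBraidElt d k ∈ unitary (PF d ℕ) := by
  have hk : k < k + 1 := Nat.lt_succ_self k
  refine sum_unitary (c_pow k) ?_ (star_c_mul k) ?_ ?_
  · rw [← star_pow, c_pow, star_one]
  · rw [star_star, c_mul_star]
  · calc star (c (k + 1) : PF d ℕ) * c k
        = star (c (k + 1)) * (c k * c (k + 1)) * star (c (k + 1)) := by
          rw [mul_assoc, mul_assoc, c_mul_star, mul_one]
      _ = q d • ((star (c (k + 1)) * c (k + 1)) * c k * star (c (k + 1))) := by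
          rw [c_comm hk, mul_smul_comm, smul_mul_assoc]
          simp only [mul_assoc]
      _ = q d • (c k * star (c (k + 1))) := by rw [star_c_mul, one_mul]

/-- The two-string braid as a unitary of `PF_∞`. -/
def twoBraid (d : ℕ) [NeZero d] (k : ℕ) : unitary (PF d ℕ) := ⟨twoBraidElt d k, twoBraidElt_mem k⟩

/-- The four-string braid exchanging the pairs of strings `(2j, 2j+1)` and `(2j+2, 2j+3)`
(strings are numbered from `0`), as a product of four two-string braids. -/
def doubleBraid (d : ℕ) [NeZero d] (j : ℕ) : unitary (PF d ℕ) :=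
  twoBraid d (2 * j + 1) * twoBraid d (2 * j) * twoBraid d (2 * j + 2) * twoBraid d (2 * j + 1)

/-- The double-braid group `𝔹_∞`, generated by the four-string braids. -/
def braidGroup (d : ℕ) [NeZero d] : Subgroup (unitary (PF d ℕ)) :=
  Subgroup.closure (Set.range (doubleBraid d))

end Braids

section States

/-- A linear functional on a unital complex `*`-algebra is a state if it is positive and unital. -/
def IsState {A : Type*} [Ring A] [StarRing A] [Algebra ℂ A] (φ : A →ₗ[ℂ] ℂ) : Prop :=
  φ 1 = 1 ∧ ∀ x : A, 0 ≤ (φ (star x * x)).re ∧ (φ (star x * x)).im = 0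

/-- The set `S_{𝔹_∞}` of states on `PF_∞` invariant under the adjoint action of `𝔹_∞`. -/
def braidInvariantStates (d : ℕ) [NeZero d] : Set (PF d ℕ →ₗ[ℂ] ℂ) :=
  {φ | IsState φ ∧ ∀ b ∈ braidGroup d, ∀ x : PF d ℕ,
    φ ((b : PF d ℕ) * x * star (b : PF d ℕ)) = φ x}

variable {d : ℕ}

/-- The embedding of `PF_2` as the algebra of the `k`-th pair of parafermions in `PF_∞`:
`c_0 ↦ c_{2k}`, `c_1 ↦ c_{2k+1}`. -/
def pairEmb (d : ℕ) (k : ℕ) : PF d (Fin 2) →ₐ[ℂ] PF d ℕ :=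
  lift (fun i => c (2 * k + i.val))
    (fun _ _ h => c_comm (Nat.add_lt_add_left (Fin.lt_def.1 h) _)) (fun _ => c_pow _)

/-- `φ` is the infinite product state `ρ^{⊗∞}`: on ordered products
`x_0 α(x_1) α²(x_2) ⋯ α^{n-1}(x_{n-1})` of elements `x_k` of `PF_2`, placed on consecutive
pairs, it takes the value `ρ(x_0) ρ(x_1) ⋯ ρ(x_{n-1})`. -/
def IsProductState (φ : PF d ℕ →ₗ[ℂ] ℂ) (ρ : PF d (Fin 2) →ₗ[ℂ] ℂ) : Prop :=
  ∀ (n : ℕ) (x : ℕ → PF d (Fin 2)),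
    φ ((List.range n).map fun k => pairEmb d k (x k)).prod = ∏ k ∈ Finset.range n, ρ (x k)

/-- The elements of charge (degree) `k ∈ ℤ/d`: the span of the monomials whose number of
generators is `k` mod `d`. -/
def chargePart (d : ℕ) (ι : Type*) [LinearOrder ι] (k : ZMod d) : Submodule ℂ (PF d ι) :=
  Submodule.span ℂ {x | ∃ l : List ι, (l.length : ZMod d) = k ∧ x = (l.map c).prod}

/-- The least positive `n` with `d ∣ n²`. -/
def leastRoot (d : ℕ) : ℕ := sInf {n : ℕ | 0 < n ∧ d ∣ n ^ 2}

/-- The elements of `PF_2` all of whose charges lie in `p₀ℤ/dℤ`. -/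
def rootChargePart (d : ℕ) : Submodule ℂ (PF d (Fin 2)) :=
  ⨆ k ∈ AddSubgroup.zmultiples ((leastRoot d : ℕ) : ZMod d), chargePart d (Fin 2) k

/-- The clock matrix. -/
def clock (d : ℕ) [NeZero d] : Matrix (ZMod d) (ZMod d) ℂ :=
  Matrix.diagonal fun i => q d ^ i.val

/-- The shift matrix `e_j ↦ e_{j+1}`. -/
def shift (d : ℕ) [NeZero d] : Matrix (ZMod d) (ZMod d) ℂ :=
  Matrix.of fun i j => if i = j + 1 then 1 else 0

theorem clock_mul_shift [NeZero d] : clock d * shift d = q d • (shift d * clock d) := by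
  ext i j
  simp only [clock, shift, Matrix.diagonal_mul, Matrix.smul_apply, Matrix.mul_diagonal,
    Matrix.of_apply, smul_eq_mul]
  split_ifs with h
  · subst h
    rw [pow_val_add (q_pow d)]
    rw [ZMod.val_one_eq_one_mod, one_mul, mul_one, mul_comm]
    congr 1
    conv_rhs => rw [← pow_one (q d), ← Nat.mod_add_div 1 d, pow_add, pow_mul, q_pow, one_pow,
      mul_one]
  · simp

theorem clock_pow [NeZero d] : clock d ^ d = 1 := by
  rw [clock, Matrix.diagonal_pow, ← Matrix.diagonal_one]
  congr 1
  ext i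
  rw [Pi.pow_apply, ← pow_mul, mul_comm, pow_mul, q_pow, one_pow]

theorem shift_pow [NeZero d] : shift d ^ d = 1 := by
  have : ∀ n : ℕ, shift d ^ n = Matrix.of fun i j => if i = j + (n : ZMod d) then 1 else 0 := by
    intro n
    induction n with
    | zero => ext i j; simp [Matrix.one_apply]
    | succ n ih =>
      rw [pow_succ, ih]
      ext i j
      simp [shift, Matrix.mul_apply, add_assoc, add_comm (1 : ZMod d)]
  rw [this]
  ext i j
  simp [Matrix.one_apply]

/-- The identification `PF_2 ≅ M_d(ℂ)`, sending the two parafermions to the clock and the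
shift matrix. -/
def toMatrix (d : ℕ) [NeZero d] : PF d (Fin 2) →ₐ[ℂ] Matrix (ZMod d) (ZMod d) ℂ :=
  lift ![clock d, shift d]
    (fun i j h => by
      fin_cases i <;> fin_cases j <;> first | exact absurd h (by decide) | exact clock_mul_shift)
    (fun i => by fin_cases i; exacts [clock_pow, shift_pow])

/-- `D` is the density matrix of the functional `ρ` on `PF_2 ≅ M_d(ℂ)`: `ρ(x) = Tr(D x)`. -/
def IsDensityMatrix [NeZero d] (D : PF d (Fin 2)) (ρ : PF d (Fin 2) →ₗ[ℂ] ℂ) : Prop :=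
  ∀ x, ρ x = Matrix.trace (toMatrix d D * toMatrix d x)

end States

end Parafermion

end

/-! # Extreme braid-invariant states of the parafermion algebra

Write `α` for the shift by one pair of generators and `ι` for the embedding of `PF_2` as the pair
`0`. The linear span of the ordered products `ι(x₀) α(ι(x₁)) α²(ι(x₂)) ⋯` is the whole algebra, so
a functional `φ` is the product `ρ^{⊗∞}` exactly when `φ 1 = 1` and `φ(ι(x) α(y)) = ρ(x) φ(y)` for
all `x` and `y` (`isProductState_iff`).

*Spreadability.* The double braid `b_j` moves an element of the pair `j + 1` to the pair `j`, and
it commutes with the pairs other than these two. Hence a braid-invariant functional takes the same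
value on `a αⁿ(y)` for all `n` for which `αⁿ(y)` lies beyond `a`
(`IsBraidInvariant.map_mul_shiftBy`). For an element `a` of the first `n` pairs, the translates
`a_k = α^{nk}(a)` therefore satisfy `φ(a_j* a_k) = C` for all `j < k`. Comparing averages over two
consecutive long blocks by the Cauchy–Schwarz inequality shows that `C` is real and nonnegative
(`norm_le_re_of_gram`). If `C = 0`, then the averages tend to zero in norm, so that
`φ(a* αⁿ(y)) = 0` for all `y` (`map_star_mul_shiftBy_eq_zero`).

*Product states are extreme.* If `φ = ρ^{⊗∞}` and `a = ι(x - ρ(x))`, then `C = 0`. In a convex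
decomposition of `φ` the numbers `C` of both components are nonnegative, so they vanish as well,
and each component is the same product state (`IsProductState.mem_extremePoints`).

*Charges.* A word `w` of charge `a` satisfies `w αⁿ(w) = s αⁿ(w) w` with `s = q^{a²}`. The numbers
`C` of `w` and of `w*` are nonnegative and differ by the phase `s` and a conjugation, so they
vanish unless `d ∣ a²`, that is, unless `p₀ ∣ a`. Thus a braid-invariant state vanishes on words
of the other charges (`map_word_eq_zero`), and the density matrix of its restriction to a pair,
expanded in the trace-orthogonal basis `c₀ⁱ c₁ʲ`, has charges in `p₀ℤ/d` only.

*Extreme states are products.* Let `φ` be extreme and let `U = ι(u)` for a word `u` of charge `a`.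
If `d ∤ a²`, then `φ(U* α(y)) = 0`. If `d ∣ a²`, put `Z_± = (1 ± λU)/2` with `|λ| = 1`. The
functionals `y ↦ φ(Z_±* α(y) Z_±)` are positive and braid-invariant, since `ι(PF_2)` commutes with
the shifted braids. Their sum is `φ`, because conjugation by `U` only gives a phase, which is
trivial on the charges where `φ` does not vanish. By extremality both are multiples of `φ`, and
the choices `λ = 1, i` yield `φ(U* α(y)) = φ(U*) φ(y)` (`map_star_word_mul_shiftBy`). -/

noncomputable section

namespace Parafermion

/-! ### Positive functionals -/

section Positive

variable {A : Type*} [Ring A] [StarRing A] [Algebra ℂ A]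

/-- Positivity of a linear functional on a unital complex `*`-algebra; in the form used for states,
without the normalisation. -/
def IsPositive (φ : A →ₗ[ℂ] ℂ) : Prop :=
  ∀ x : A, 0 ≤ (φ (star x * x)).re ∧ (φ (star x * x)).im = 0

variable {φ : A →ₗ[ℂ] ℂ}

theorem IsState.isPositive (hφ : IsState φ) : IsPositive φ := hφ.2

variable [StarModule ℂ A]

theorem IsPositive.map_star (hφ : IsPositive φ) (x : A) :
    φ (star x) = starRingEnd ℂ (φ x) := by
  have e0 := (hφ 1).2
  have ex := (hφ x).2
  have e1 := (hφ (1 + x)).2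
  have e2 := (hφ (1 + Complex.I • x)).2
  simp only [star_one, mul_one, star_add, star_smul, add_mul, mul_add, one_mul, map_add,
    Complex.add_im, smul_mul_assoc, mul_smul_comm, map_smul, smul_eq_mul, RCLike.star_def,
    Complex.conj_I, Complex.mul_im, Complex.mul_re, Complex.I_re, Complex.I_im, Complex.neg_re,
    Complex.neg_im] at e0 ex e1 e2
  apply Complex.ext
  · simp only [Complex.conj_re]
    nlinarith
  · simp only [Complex.conj_im]
    nlinarith

theorem IsPositive.map_star_mul (hφ : IsPositive φ) (x y : A) :
    φ (star y * x) = starRingEnd ℂ (φ (star x * y)) := by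
  rw [← hφ.map_star, star_mul, star_star]

/-- The semi-inner product `⟪x, y⟫ = φ(x* y)`. -/
@[reducible] def IsPositive.preInner (hφ : IsPositive φ) : PreInnerProductSpace.Core ℂ A where
  inner x y := φ (star x * y)
  conj_inner_symm x y := (hφ.map_star_mul y x).symm
  re_inner_nonneg x := (hφ x).1
  add_left x y z := by simp [add_mul]
  smul_left x y r := by simp

/-- The Cauchy–Schwarz inequality for a positive functional. -/
theorem IsPositive.norm_sq_le (hφ : IsPositive φ) (x y : A) :
    ‖φ (star x * y)‖ ^ 2 ≤ (φ (star x * x)).re * (φ (star y * y)).re := by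
  have h := @InnerProductSpace.Core.inner_mul_inner_self_le ℂ A _ _ _ hφ.preInner x y
  have h' : ‖φ (star x * y)‖ * ‖φ (star y * x)‖ ≤ (φ (star x * x)).re * (φ (star y * y)).re := h
  rw [hφ.map_star_mul x y, RCLike.norm_conj] at h'
  rwa [sq]

theorem IsPositive.eq_zero_of_map_one (hφ : IsPositive φ) (h : φ 1 = 0) : φ = 0 := by
  ext x
  have := hφ.norm_sq_le 1 x
  simp only [star_one, one_mul, mul_one, h, Complex.zero_re, zero_mul] at this
  simpa using this

theorem re_map_star_sum_mul_sum (hφ : IsPositive φ) {v : ℕ → A} {C : ℂ} {M : ℝ}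
    (hC : ∀ j k, j < k → φ (star (v j) * v k) = C) (hM : ∀ k, (φ (star (v k) * v k)).re = M)
    (n : ℕ) :
    (φ (star (∑ k ∈ Finset.range n, v k) * ∑ k ∈ Finset.range n, v k)).re =
      n * M + n * (n - 1) * C.re := by
  induction n with
  | zero => simp
  | succ n ih =>
    have h1 : φ (star (∑ k ∈ Finset.range n, v k) * v n) = n * C := by
      rw [star_sum, Finset.sum_mul, map_sum,
        Finset.sum_congr rfl fun k hk => hC k n (Finset.mem_range.1 hk)]
      simp
    rw [Finset.sum_range_succ, star_add, add_mul, mul_add, mul_add, map_add, map_add, map_add,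
      h1, hφ.map_star_mul _ (v n), h1]
    simp only [Complex.add_re, ih, hM, Complex.conj_re, Complex.mul_re, Complex.natCast_re,
      Complex.natCast_im, zero_mul, sub_zero]
    push_cast
    ring

/-- In a sequence whose Gram matrix has the constant value `C` above the diagonal and a constant
diagonal, the averages over two consecutive long blocks have squared norms tending to `Re C`, and
inner product `C`; hence `C` is a nonnegative real number. -/
theorem norm_le_re_of_gram (hφ : IsPositive φ) {v : ℕ → A} {C : ℂ} {M : ℝ}
    (hC : ∀ j k, j < k → φ (star (v j) * v k) = C) (hM : ∀ k, (φ (star (v k) * v k)).re = M) :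
    ‖C‖ ≤ C.re := by
  have key : ∀ n : ℕ, (n : ℝ) * (‖C‖ - C.re) ≤ |M - C.re| := by
    intro n
    rcases Nat.eq_zero_or_pos n with rfl | hn
    · simp
    have h1 := re_map_star_sum_mul_sum hφ hC hM n
    have h2 := re_map_star_sum_mul_sum hφ (v := fun k => v (n + k))
      (fun j k h => hC _ _ (Nat.add_lt_add_left h n)) (fun k => hM _) n
    have h3 := hφ.norm_sq_le (∑ k ∈ Finset.range n, v k) (∑ k ∈ Finset.range n, v (n + k))
    have h4 : φ (star (∑ k ∈ Finset.range n, v k) * ∑ k ∈ Finset.range n, v (n + k)) =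
        n * (n * C) := by
      rw [star_sum, Finset.sum_mul_sum, map_sum]
      rw [Finset.sum_congr rfl fun j hj => (by
        rw [map_sum, Finset.sum_congr rfl fun k _ => hC j (n + k)
          (lt_of_lt_of_le (Finset.mem_range.1 hj) (Nat.le_add_right _ _))])]
      simp
    have h5 := (hφ (∑ k ∈ Finset.range n, v k)).1
    rw [h4, h1, h2, ← sq] at h3
    rw [h1] at h5
    have h6 := (sq_le_sq₀ (norm_nonneg _) h5).1 h3
    rw [norm_mul, norm_mul, Complex.norm_natCast] at h6
    have hn' : (0 : ℝ) < n := by exact_mod_cast hn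
    have h7 : (n : ℝ) * ‖C‖ ≤ M + (n - 1) * C.re := by
      refine le_of_mul_le_mul_left ?_ hn'
      linarith
    linarith [le_abs_self (M - C.re)]
  by_contra h
  obtain ⟨n, hn⟩ := exists_nat_gt (|M - C.re| / (‖C‖ - C.re))
  rw [div_lt_iff₀ (by linarith)] at hn
  linarith [key n]

/-- If the Gram matrix of a sequence vanishes above the diagonal and has a constant diagonal, then
the averages of the sequence tend to zero in norm, so that an inner product with a bounded vector
that takes the same value along arbitrarily long initial segments must vanish. -/
theorem eq_zero_of_gram (hφ : IsPositive φ) {v : ℕ → A} {M : ℝ}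
    (hC : ∀ j k, j < k → φ (star (v j) * v k) = 0) (hM : ∀ k, (φ (star (v k) * v k)).re = M)
    {K : ℝ} {E : ℂ} (u : ℕ → A) (hK : ∀ n, (φ (star (u n) * u n)).re = K)
    (hE : ∀ k n, k < n → φ (star (v k) * u n) = E) : E = 0 := by
  have key : ∀ n : ℕ, (n : ℝ) * ‖E‖ ^ 2 ≤ M * K := by
    intro n
    rcases Nat.eq_zero_or_pos n with rfl | hn
    · have h1 := (hφ (v 0)).1
      have h2 := (hφ (u 0)).1
      rw [hM] at h1
      rw [hK] at h2
      simpa using mul_nonneg h1 h2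
    have h1 := re_map_star_sum_mul_sum hφ hC hM n
    have h3 := hφ.norm_sq_le (∑ k ∈ Finset.range n, v k) (u n)
    have h4 : φ (star (∑ k ∈ Finset.range n, v k) * u n) = n * E := by
      rw [star_sum, Finset.sum_mul, map_sum,
        Finset.sum_congr rfl fun k hk => hE k n (Finset.mem_range.1 hk)]
      simp
    rw [h4, h1, hK, norm_mul, Complex.norm_natCast] at h3
    have hn' : (0 : ℝ) < n := by exact_mod_cast hn
    refine le_of_mul_le_mul_left ?_ hn'
    simp only [Complex.zero_re, mul_zero, add_zero] at h3
    linarith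
  by_contra h
  have hpos : 0 < ‖E‖ ^ 2 := by positivity
  obtain ⟨n, hn⟩ := exists_nat_gt (M * K / ‖E‖ ^ 2)
  rw [div_lt_iff₀ hpos] at hn
  linarith [key n]

end Positive

/-! ### Words, shifts and local subalgebras -/

section Words

variable {d : ℕ} {ι κ : Type*} [LinearOrder ι] [LinearOrder κ]

theorem q_isPrimitiveRoot (d : ℕ) [NeZero d] : IsPrimitiveRoot (q d) d :=
  Complex.isPrimitiveRoot_exp d (NeZero.ne d)

theorem q_ne_zero (d : ℕ) : q d ≠ 0 := Complex.exp_ne_zero _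

theorem norm_q (d : ℕ) : ‖q d‖ = 1 := by
  have h := congrArg norm (conj_q_mul d)
  rw [norm_mul, RCLike.norm_conj, norm_one] at h
  nlinarith [norm_nonneg (q d)]

theorem algHom_ext {A : Type*} [Ring A] [Algebra ℂ A] {f g : PF d ι →ₐ[ℂ] A}
    (h : ∀ i, f (c i) = g (c i)) : f = g := by
  ext x
  induction x using induction with
  | h0 r => simp
  | h1 j => exact h j
  | hm x y hx hy => rw [map_mul, map_mul, hx, hy]
  | ha x y hx hy => rw [map_add, map_add, hx, hy]

theorem eq_top_of_c_mul_mem (T : Submodule ℂ (PF d ι)) (h1 : 1 ∈ T)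
    (hc : ∀ i, ∀ y ∈ T, c i * y ∈ T) : T = ⊤ := by
  have key : ∀ x : PF d ι, ∀ y ∈ T, x * y ∈ T := by
    intro x
    induction x using induction with
    | h0 r => intro y hy; rw [← Algebra.smul_def]; exact T.smul_mem _ hy
    | h1 j => exact hc j
    | hm x y hx hy => intro z hz; rw [mul_assoc]; exact hx _ (hy _ hz)
    | ha x y hx hy => intro z hz; rw [add_mul]; exact T.add_mem (hx _ hz) (hy _ hz)
  refine (Submodule.eq_top_iff' ).2 fun x => ?_
  simpa using key x 1 h1

/-- The product of the generators with the indices in the list `l`. -/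
def word (d : ℕ) {ι : Type*} [LinearOrder ι] (l : List ι) : PF d ι := (l.map c).prod

@[simp] theorem word_nil : word d ([] : List ι) = 1 := rfl

theorem word_cons (i : ι) (l : List ι) : word d (i :: l) = c i * word d l := by
  simp [word]

theorem eq_top_of_word_mem (T : Submodule ℂ (PF d ι)) (h : ∀ l : List ι, word d l ∈ T) :
    T = ⊤ := by
  have : Submodule.span ℂ (Set.range (word d (ι := ι))) = ⊤ := by
    refine eq_top_of_c_mul_mem _ (Submodule.subset_span ⟨[], rfl⟩) fun i y hy => ?_
    induction hy using Submodule.span_induction with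
    | mem x hx =>
      obtain ⟨l, rfl⟩ := hx
      exact Submodule.subset_span ⟨i :: l, word_cons i l⟩
    | zero => simp
    | add x y _ _ hx hy => rw [mul_add]; exact Submodule.add_mem _ hx hy
    | smul a x _ hx => rw [mul_smul_comm]; exact Submodule.smul_mem _ _ hx
  rw [eq_top_iff, ← this, Submodule.span_le]
  rintro _ ⟨l, rfl⟩
  exact h l

theorem c_mul_word (i : ι) (l : List ι) (h : ∀ j ∈ l, i < j) :
    c i * word d l = q d ^ l.length • (word d l * c i) := by
  induction l with
  | nil => simp
  | cons j l ih =>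
    rw [word_cons, ← mul_assoc, c_comm (h j (by simp)), smul_mul_assoc, mul_assoc,
      ih fun k hk => h k (by simp [hk]), mul_smul_comm, smul_smul, List.length_cons, pow_succ',
      mul_assoc]

theorem word_mul_word (l l' : List ι) (h : ∀ i ∈ l, ∀ j ∈ l', i < j) :
    word d l * word d l' = q d ^ (l.length * l'.length) • (word d l' * word d l) := by
  induction l with
  | nil => simp
  | cons i l ih =>
    rw [word_cons, mul_assoc, ih fun k hk => h k (by simp [hk]), mul_smul_comm, ← mul_assoc,
      c_mul_word i l' (h i (by simp)), smul_mul_assoc, smul_smul, mul_assoc, ← pow_add,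
      List.length_cons]
    congr 2
    ring

theorem map_word {f : PF d ι →ₐ[ℂ] PF d κ} {g : ι → κ} (h : ∀ i, f (c i) = c (g i))
    (l : List ι) : f (word d l) = word d (l.map g) := by
  induction l with
  | nil => simp
  | cons i l ih => rw [word_cons, map_mul, ih, h, List.map_cons, word_cons]

variable [NeZero d]

theorem map_star_of_c {f : PF d ι →ₐ[ℂ] PF d κ} {g : ι → κ} (h : ∀ i, f (c i) = c (g i))
    (x : PF d ι) : f (star x) = star (f x) := by
  induction x using induction with
  | h0 r => rw [star_algebraMap, AlgHom.commutes, AlgHom.commutes, star_algebraMap]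
  | h1 j => rw [star_c, map_pow, h, star_c]
  | hm x y hx hy => rw [star_mul, map_mul, hx, hy, map_mul, star_mul]
  | ha x y hx hy => rw [star_add, map_add, hx, hy, map_add, star_add]

theorem word_mem_unitary (l : List ι) : word d l ∈ unitary (PF d ι) := by
  induction l with
  | nil => exact one_mem _
  | cons i l ih =>
    rw [word_cons]
    exact mul_mem (Unitary.mem_iff.2 ⟨star_c_mul i, c_mul_star i⟩) ih

end Words

section Shift

variable {d : ℕ}

/-- The shift of `PF_∞` by `n` pairs of generators, `c_i ↦ c_{i + 2n}`. -/
def shiftBy (d n : ℕ) : PF d ℕ →ₐ[ℂ] PF d ℕ :=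
  lift (fun i => c (i + 2 * n)) (fun _ _ h => c_comm (Nat.add_lt_add_right h _)) (fun _ => c_pow _)

@[simp] theorem shiftBy_c (n i : ℕ) : shiftBy d n (c i) = c (i + 2 * n) := lift_c _ _ _ _

@[simp] theorem pairEmb_c (k : ℕ) (i : Fin 2) : pairEmb d k (c i) = c (2 * k + i.val) :=
  lift_c _ _ _ _

theorem shiftBy_shiftBy (m n : ℕ) (x : PF d ℕ) :
    shiftBy d m (shiftBy d n x) = shiftBy d (n + m) x := by
  refine DFunLike.congr_fun (f := (shiftBy d m).comp (shiftBy d n)) (algHom_ext fun i => ?_) x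
  simp only [AlgHom.comp_apply, shiftBy_c]
  congr 1
  ring

theorem shiftBy_zero (x : PF d ℕ) : shiftBy d 0 x = x := by
  refine DFunLike.congr_fun (f := shiftBy d 0) (g := AlgHom.id ℂ _) (algHom_ext fun i => ?_) x
  simp

theorem shiftBy_pairEmb (m n : ℕ) (x : PF d (Fin 2)) :
    shiftBy d m (pairEmb d n x) = pairEmb d (n + m) x := by
  refine DFunLike.congr_fun (f := (shiftBy d m).comp (pairEmb d n)) (algHom_ext fun i => ?_) x
  simp only [AlgHom.comp_apply, shiftBy_c, pairEmb_c]
  congr 1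
  ring

/-- The subalgebra generated by the first `n` pairs of generators. -/
def initialPairs (d n : ℕ) : Subalgebra ℂ (PF d ℕ) := Algebra.adjoin ℂ (c '' {i | i < 2 * n})

theorem c_mem_initialPairs {i n : ℕ} (h : i < 2 * n) : (c i : PF d ℕ) ∈ initialPairs d n :=
  Algebra.subset_adjoin ⟨i, h, rfl⟩

theorem initialPairs_mono {m n : ℕ} (h : m ≤ n) : initialPairs d m ≤ initialPairs d n := by
  refine Algebra.adjoin_mono (Set.image_mono fun i hi => ?_)
  simp only [Set.mem_ofPred_eq] at *
  omega

theorem shiftBy_mem_initialPairs {m n : ℕ} {x : PF d ℕ} (hx : x ∈ initialPairs d m) :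
    shiftBy d n x ∈ initialPairs d (m + n) := by
  have : initialPairs d m ≤ (initialPairs d (m + n)).comap (shiftBy d n) := by
    refine Algebra.adjoin_le ?_
    rintro _ ⟨i, hi, rfl⟩
    simp only [Set.mem_ofPred_eq] at hi
    simp only [Subalgebra.coe_comap, Set.mem_preimage, shiftBy_c, SetLike.mem_coe]
    exact c_mem_initialPairs (by omega)
  exact this hx

theorem pairEmb_mem_initialPairs (n : ℕ) (x : PF d (Fin 2)) :
    pairEmb d n x ∈ initialPairs d (n + 1) := by
  induction x using induction with
  | h0 r => rw [AlgHom.commutes]; exact Subalgebra.algebraMap_mem _ _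
  | h1 j => rw [pairEmb_c]; exact c_mem_initialPairs (by omega)
  | hm x y hx hy => rw [map_mul]; exact mul_mem hx hy
  | ha x y hx hy => rw [map_add]; exact add_mem hx hy

theorem word_mem_initialPairs {l : List ℕ} {n : ℕ} (h : ∀ i ∈ l, i < 2 * n) :
    word d l ∈ initialPairs d n := by
  induction l with
  | nil => exact one_mem _
  | cons i l ih =>
    rw [word_cons]
    exact mul_mem (c_mem_initialPairs (h i (by simp))) (ih fun k hk => h k (by simp [hk]))

theorem exists_lt_two_mul (l : List ℕ) : ∃ n, ∀ i ∈ l, i < 2 * n :=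
  ⟨l.sum + 1, fun i hi => by have := List.le_sum_of_mem hi; omega⟩

theorem word_mul_shiftBy_word {l : List ℕ} {n : ℕ} (h : ∀ i ∈ l, i < 2 * n) (l' : List ℕ) :
    word d l * shiftBy d n (word d l') =
      q d ^ (l.length * l'.length) • (shiftBy d n (word d l') * word d l) := by
  rw [map_word (shiftBy_c n), word_mul_word, List.length_map]
  intro i hi j hj
  obtain ⟨k, -, rfl⟩ := List.mem_map.1 hj
  have := h i hi
  omega

/-- The endomorphism of `PF_2` multiplying both generators by `q⁻¹`; it implements moving a
generator of a later pair past an element of `PF_2`. -/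
def gauge (d : ℕ) [NeZero d] : PF d (Fin 2) →ₐ[ℂ] PF d (Fin 2) :=
  lift (fun i => (q d)⁻¹ • c i)
    (fun j k h => by
      rw [smul_mul_smul_comm, smul_mul_smul_comm, c_comm h, smul_comm])
    (fun j => by rw [smul_pow, c_pow, inv_pow, q_pow, inv_one, one_smul])

theorem c_mul_pairEmb_zero [NeZero d] (i : ℕ) (x : PF d (Fin 2)) :
    c (i + 2) * pairEmb d 0 x = pairEmb d 0 (gauge d x) * c (i + 2) := by
  induction x using induction with
  | h0 r => rw [AlgHom.commutes, AlgHom.commutes, AlgHom.commutes, Algebra.commutes]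
  | h1 j =>
    rw [gauge, lift_c, map_smul, pairEmb_c, smul_mul_assoc,
      c_comm (show 2 * 0 + j.val < i + 2 by omega), smul_smul, inv_mul_cancel₀ (q_ne_zero d),
      one_smul]
  | hm x y hx hy => rw [map_mul, ← mul_assoc, hx, mul_assoc, hy, ← mul_assoc, map_mul, map_mul]
  | ha x y hx hy => rw [map_add, mul_add, hx, hy, map_add, map_add, add_mul]

/-- A subspace of `PF_∞` containing `1` and stable under `y ↦ x · α(y)`, for `x` in the algebra of
the pair `0` and `α` the shift by one pair, is the whole algebra: this is an induction principle on
the number of pairs. -/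
theorem eq_top_of_pairEmb_mul_shiftBy_mem [NeZero d] (T : Submodule ℂ (PF d ℕ)) (h1 : 1 ∈ T)
    (hT : ∀ x, ∀ y ∈ T, pairEmb d 0 x * shiftBy d 1 y ∈ T) : T = ⊤ := by
  -- The intersection `I` of all such subspaces is stable under left multiplication by generators.
  let I : Submodule ℂ (PF d ℕ) := sInf {T | 1 ∈ T ∧
    ∀ x, ∀ y ∈ T, pairEmb d 0 x * shiftBy d 1 y ∈ T}
  have hI1 : 1 ∈ I := (Submodule.mem_sInf).2 fun T hT => hT.1
  have hI : ∀ x, ∀ y ∈ I, pairEmb d 0 x * shiftBy d 1 y ∈ I := fun x y hy =>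
    (Submodule.mem_sInf).2 fun T hT => hT.2 x y ((Submodule.mem_sInf).1 hy T hT)
  have hc1 : ∀ i : Fin 2, (c i.val : PF d ℕ) = pairEmb d 0 (c i) := fun i => by simp
  have hc2 : ∀ i, (c (i + 2) : PF d ℕ) = shiftBy d 1 (c i) := fun i => by simp
  have hJ : I ≤ (I ⊓ ⨅ i : ℕ, I.comap (LinearMap.mulLeft ℂ (c i))) := by
    refine sInf_le ⟨?_, ?_⟩
    · refine ⟨hI1, (Submodule.mem_iInf _).2 fun i => ?_⟩
      simp only [Submodule.mem_comap, LinearMap.mulLeft_apply, mul_one]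
      induction i using Nat.strong_induction_on with
      | _ i ih =>
        rcases lt_or_ge i 2 with h | h
        · have := hI (c ⟨i, h⟩) 1 hI1
          simpa using this
        · obtain ⟨j, rfl⟩ := Nat.exists_eq_add_of_le' h
          have := hI 1 _ (ih j (by omega))
          simpa using this
    · rintro x y ⟨hy, hy'⟩
      rw [SetLike.mem_coe, Submodule.mem_iInf] at hy'
      simp only [Submodule.mem_comap, LinearMap.mulLeft_apply] at hy'
      refine ⟨hI x y hy, (Submodule.mem_iInf _).2 fun i => ?_⟩
      simp only [Submodule.mem_comap, LinearMap.mulLeft_apply]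
      rcases lt_or_ge i 2 with h | h
      · have := hI (c ⟨i, h⟩ * x) y hy
        simpa [mul_assoc] using this
      · obtain ⟨j, rfl⟩ := Nat.exists_eq_add_of_le' h
        rw [← mul_assoc, c_mul_pairEmb_zero, mul_assoc, hc2, ← map_mul]
        exact hI _ _ (hy' j)
  have hItop : I = ⊤ := by
    refine eq_top_of_c_mul_mem I hI1 fun i y hy => ?_
    have := (hJ hy).2
    rw [SetLike.mem_coe, Submodule.mem_iInf] at this
    exact this i
  exact eq_top_iff.2 (hItop ▸ sInf_le ⟨h1, hT⟩)

variable [NeZero d]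

theorem shiftBy_star (n : ℕ) (x : PF d ℕ) : shiftBy d n (star x) = star (shiftBy d n x) :=
  map_star_of_c (shiftBy_c n) x

theorem pairEmb_star (n : ℕ) (x : PF d (Fin 2)) : pairEmb d n (star x) = star (pairEmb d n x) :=
  map_star_of_c (pairEmb_c n) x

theorem star_mem_initialPairs {n : ℕ} {x : PF d ℕ} (hx : x ∈ initialPairs d n) :
    star x ∈ initialPairs d n := by
  induction hx using Algebra.adjoin_induction with
  | mem x hx =>
    obtain ⟨i, hi, rfl⟩ := hx
    rw [star_c]
    exact pow_mem (c_mem_initialPairs hi) _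
  | algebraMap r => rw [star_algebraMap]; exact Subalgebra.algebraMap_mem _ _
  | add x y _ _ hx hy => rw [star_add]; exact add_mem hx hy
  | mul x y _ _ hx hy => rw [star_mul]; exact mul_mem hy hx

end Shift

/-! ### The action of the double braids -/

section Braid

theorem pow_val_one {d : ℕ} {A : Type*} [Monoid A] {u : A} (hu : u ^ d = 1) :
    u ^ (1 : ZMod d).val = u := by
  conv_rhs => rw [← pow_one u, ← Nat.mod_add_div 1 d, pow_add, pow_mul, hu, one_pow, mul_one]
  rw [ZMod.val_one_eq_one_mod]

variable {d : ℕ} [NeZero d]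

theorem twoBraidElt_mul_c_succ (k : ℕ) :
    twoBraidElt d k * c (k + 1) = c k * twoBraidElt d k := by
  have hs : star (c (k + 1) : PF d ℕ) ^ d = 1 := by rw [← star_pow, c_pow, star_one]
  rw [twoBraidElt, smul_mul_assoc, mul_smul_comm, Finset.sum_mul, Finset.mul_sum]
  congr 1
  refine (Fintype.sum_equiv (Equiv.addRight (1 : ZMod d)) _ _ fun i => ?_).symm
  rw [Equiv.coe_addRight]
  beta_reduce
  rw [pow_val_add hs, pow_val_one hs, add_comm i 1, pow_val_add (c_pow k), pow_val_one (c_pow k)]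
  simp only [mul_assoc, star_c_mul, mul_one]

/-- An element that picks up the same scalar when moved past `u` and past a unitary `w` commutes
with `uⁱ w⁻ⁱ`. -/
theorem commute_pow_mul_star_pow {A : Type*} [Ring A] [StarRing A] [Algebra ℂ A] {u v w : A}
    {z : ℂ} (hu : v * u = z • (u * v)) (hw : v * w = z • (w * v)) (hw1 : w ∈ unitary A) (i : ℕ) :
    Commute v (u ^ i * star w ^ i) := by
  have h1 : v * u ^ i = z ^ i • (u ^ i * v) := by simpa using pow_comm_aux hu 1 i
  have h2 : v * w ^ i = z ^ i • (w ^ i * v) := by simpa using pow_comm_aux hw 1 i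
  obtain ⟨h3, h4⟩ := Unitary.mem_iff.1 (pow_mem hw1 i)
  rw [star_pow] at h3 h4
  have h5 : star w ^ i * v = z ^ i • (v * star w ^ i) := by
    calc star w ^ i * v = star w ^ i * (v * w ^ i) * star w ^ i := by
          rw [mul_assoc, mul_assoc, h4, mul_one]
      _ = z ^ i • (star w ^ i * w ^ i * v * star w ^ i) := by
          rw [h2, mul_smul_comm, smul_mul_assoc]; simp only [mul_assoc]
      _ = _ := by rw [h3, one_mul]
  rw [Commute, SemiconjBy, ← mul_assoc, h1, smul_mul_assoc, mul_assoc, mul_assoc, h5,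
    mul_smul_comm]

theorem commute_c_twoBraidElt {j k : ℕ} (h1 : j ≠ k) (h2 : j ≠ k + 1) :
    Commute (c j) (twoBraidElt d k) := by
  have hw : (c (k + 1) : PF d ℕ) ∈ unitary (PF d ℕ) :=
    Unitary.mem_iff.2 ⟨star_c_mul _, c_mul_star _⟩
  have key : ∀ i : ℕ, Commute (c j : PF d ℕ) (c k ^ i * star (c (k + 1)) ^ i) := by
    rcases lt_or_gt_of_ne h1 with h | h
    · exact commute_pow_mul_star_pow (c_comm h) (c_comm (by omega)) hw
    · have hk : k + 1 < j := by omega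
      refine commute_pow_mul_star_pow (z := (q d)⁻¹) ?_ ?_ hw
      · rw [c_comm h, smul_smul, inv_mul_cancel₀ (q_ne_zero d), one_smul]
      · rw [c_comm hk, smul_smul, inv_mul_cancel₀ (q_ne_zero d), one_smul]
  exact Commute.smul_right (Commute.sum_right _ _ _ fun i _ => key _) _

theorem coe_doubleBraid (j : ℕ) : (doubleBraid d j : PF d ℕ) =
    twoBraidElt d (2 * j + 1) * twoBraidElt d (2 * j) * twoBraidElt d (2 * j + 2) *
      twoBraidElt d (2 * j + 1) := rfl

theorem commute_c_doubleBraid {i j : ℕ} (h : i < 2 * j ∨ 2 * j + 3 < i) :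
    Commute (c i) (doubleBraid d j : PF d ℕ) := by
  rw [coe_doubleBraid]
  exact (((commute_c_twoBraidElt (by omega) (by omega)).mul_right
    (commute_c_twoBraidElt (by omega) (by omega))).mul_right
    (commute_c_twoBraidElt (by omega) (by omega))).mul_right
    (commute_c_twoBraidElt (by omega) (by omega))

theorem doubleBraid_mul_pairEmb (j : ℕ) (x : PF d (Fin 2)) :
    (doubleBraid d j : PF d ℕ) * pairEmb d (j + 1) x = pairEmb d j x * doubleBraid d j := by
  induction x using induction with
  | h0 r => rw [AlgHom.commutes, AlgHom.commutes, Algebra.commutes]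
  | h1 i =>
    have e1 := twoBraidElt_mul_c_succ (d := d) (2 * j)
    have e2 := twoBraidElt_mul_c_succ (d := d) (2 * j + 1)
    have e3 := twoBraidElt_mul_c_succ (d := d) (2 * j + 2)
    have f1 := (commute_c_twoBraidElt (d := d) (j := 2 * j) (k := 2 * j + 1)
      (by omega) (by omega)).eq
    have f2 := (commute_c_twoBraidElt (d := d) (j := 2 * j) (k := 2 * j + 2)
      (by omega) (by omega)).eq
    have f3 := (commute_c_twoBraidElt (d := d) (j := 2 * j + 2) (k := 2 * j)
      (by omega) (by omega)).eq
    have f4 := (commute_c_twoBraidElt (d := d) (j := 2 * j + 3) (k := 2 * j + 1)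
      (by omega) (by omega)).eq
    have f5 := (commute_c_twoBraidElt (d := d) (j := 2 * j + 1) (k := 2 * j + 2)
      (by omega) (by omega)).eq
    rw [pairEmb_c, pairEmb_c, coe_doubleBraid]
    fin_cases i
    · simp only [add_zero, mul_add, mul_one]
      rw [mul_assoc, e2, ← mul_assoc, mul_assoc _ _ (c (2 * j + 1)), ← f5, ← mul_assoc,
        mul_assoc _ _ (c (2 * j + 1)), e1, ← mul_assoc, ← f1]
      simp only [mul_assoc]
    · simp only [mul_add, mul_one]
      rw [mul_assoc, ← f4, ← mul_assoc, mul_assoc _ _ (c (2 * j + 3)), e3, ← mul_assoc,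
        mul_assoc _ _ (c (2 * j + 2)), ← f3, ← mul_assoc, e2]
      simp only [mul_assoc]
  | hm x y hx hy => rw [map_mul, ← mul_assoc, hx, mul_assoc, hy, ← mul_assoc, map_mul]
  | ha x y hx hy => rw [map_add, mul_add, hx, hy, map_add, add_mul]

theorem commute_doubleBraid_of_mem_initialPairs {n : ℕ} {a : PF d ℕ}
    (ha : a ∈ initialPairs d n) : Commute a (doubleBraid d n : PF d ℕ) := by
  induction ha using Algebra.adjoin_induction with
  | mem x hx =>
    obtain ⟨i, hi, rfl⟩ := hx
    exact commute_c_doubleBraid (Or.inl hi)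
  | algebraMap r => exact Algebra.commutes r _
  | add x y _ _ hx hy => exact hx.add_left hy
  | mul x y _ _ hx hy => exact hx.mul_left hy

theorem commute_shiftBy_doubleBraid (n : ℕ) (y : PF d ℕ) :
    Commute (shiftBy d (n + 2) y) (doubleBraid d n : PF d ℕ) := by
  induction y using induction with
  | h0 r => rw [AlgHom.commutes]; exact Algebra.commutes r _
  | h1 i => rw [shiftBy_c]; exact commute_c_doubleBraid (Or.inr (by omega))
  | hm x y hx hy => rw [map_mul]; exact hx.mul_left hy
  | ha x y hx hy => rw [map_add]; exact hx.add_left hy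

theorem shiftBy_twoBraidElt (n k : ℕ) :
    shiftBy d n (twoBraidElt d k) = twoBraidElt d (k + 2 * n) := by
  simp only [twoBraidElt, map_smul, map_sum, map_mul, map_pow, shiftBy_star, shiftBy_c]
  congr 1
  refine Finset.sum_congr rfl fun i _ => ?_
  rw [show k + 1 + 2 * n = k + 2 * n + 1 by ring]

theorem shiftBy_doubleBraid (n j : ℕ) :
    shiftBy d n (doubleBraid d j : PF d ℕ) = doubleBraid d (j + n) := by
  simp only [coe_doubleBraid, map_mul, shiftBy_twoBraidElt]
  rw [show 2 * j + 1 + 2 * n = 2 * (j + n) + 1 by ring, show 2 * j + 2 * n = 2 * (j + n) by ring,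
    show 2 * j + 2 + 2 * n = 2 * (j + n) + 2 by ring]

theorem commute_pairEmb_zero_doubleBraid_succ (j : ℕ) (x : PF d (Fin 2)) :
    Commute (pairEmb d 0 x) (doubleBraid d (j + 1) : PF d ℕ) :=
  commute_doubleBraid_of_mem_initialPairs
    (initialPairs_mono (by omega) (pairEmb_mem_initialPairs 0 x))

end Braid

/-! ### Spreadability of braid-invariant functionals -/

section Spread

variable {d : ℕ} [NeZero d] {φ : PF d ℕ →ₗ[ℂ] ℂ}

/-- Invariance under conjugation by the generators of the double-braid group. -/
def IsBraidInvariant (φ : PF d ℕ →ₗ[ℂ] ℂ) : Prop :=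
  ∀ (j : ℕ) (x : PF d ℕ), φ (doubleBraid d j * x * star (doubleBraid d j : PF d ℕ)) = φ x

theorem isBraidInvariant_iff : IsBraidInvariant φ ↔
    ∀ b ∈ braidGroup d, ∀ x : PF d ℕ, φ ((b : PF d ℕ) * x * star (b : PF d ℕ)) = φ x := by
  refine ⟨fun h b hb => ?_, fun h j x => h _ (Subgroup.subset_closure ⟨j, rfl⟩) x⟩
  induction hb using Subgroup.closure_induction with
  | mem b hb => obtain ⟨j, rfl⟩ := hb; exact h j
  | one => intro x; simp
  | mul a b _ _ ha hb =>
    intro x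
    rw [← hb x, ← ha (b * x * star (b : PF d ℕ))]
    simp [mul_assoc]
  | inv b _ hb =>
    intro x
    have h1 : (b : PF d ℕ) * star (b : PF d ℕ) = 1 := Unitary.coe_mul_star_self b
    have h2 : ((b⁻¹ : unitary (PF d ℕ)) : PF d ℕ) = star (b : PF d ℕ) := rfl
    rw [← hb, h2, star_star]
    congr 1
    calc (b : PF d ℕ) * (star (b : PF d ℕ) * x * b) * star (b : PF d ℕ)
        = b * star (b : PF d ℕ) * x * (b * star (b : PF d ℕ)) := by simp only [mul_assoc]
      _ = x := by rw [h1, one_mul, mul_one]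

theorem IsBraidInvariant.map_conj (hφ : IsBraidInvariant φ) {j : ℕ} {x y : PF d ℕ}
    (h : (doubleBraid d j : PF d ℕ) * x = y * doubleBraid d j) : φ x = φ y := by
  have h1 : (doubleBraid d j : PF d ℕ) * star (doubleBraid d j : PF d ℕ) = 1 :=
    Unitary.coe_mul_star_self _
  rw [← hφ j x, h, mul_assoc, h1, mul_one]

/-- Spreadability: a block of pairs may be moved over one empty pair. The double braid `j` moves an
element of the pair `j + 1` to the empty pair `j`, and the pairs of the block are moved one after
the other, beginning with the first. -/
theorem IsBraidInvariant.map_mul_shiftBy_succ (hφ : IsBraidInvariant φ) (y : PF d ℕ) :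
    ∀ (n : ℕ), ∀ a ∈ initialPairs d n,
      φ (a * shiftBy d (n + 1) y) = φ (a * shiftBy d n y) := by
  let T : Submodule ℂ (PF d ℕ) :=
    { carrier := {y | ∀ (n : ℕ), ∀ a ∈ initialPairs d n,
        φ (a * shiftBy d (n + 1) y) = φ (a * shiftBy d n y)}
      add_mem' := fun {x y} hx hy n a ha => by
        simp only [map_add, mul_add, hx n a ha, hy n a ha]
      zero_mem' := fun n a _ => by simp
      smul_mem' := fun r x hx n a ha => by
        simp only [map_smul, mul_smul_comm, hx n a ha] }
  have hT : T = ⊤ := by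
    refine eq_top_of_pairEmb_mul_shiftBy_mem T (fun n a _ => by simp) fun x y hy n a ha => ?_
    have h1 : φ (a * shiftBy d (n + 1) (pairEmb d 0 x * shiftBy d 1 y)) =
        φ (a * pairEmb d n x * shiftBy d (n + 2) y) := by
      refine hφ.map_conj (j := n) ?_
      rw [map_mul, shiftBy_pairEmb, shiftBy_shiftBy, zero_add,
        show 1 + (n + 1) = n + 2 by ring, ← mul_assoc,
        ← (commute_doubleBraid_of_mem_initialPairs ha).eq, mul_assoc, ← mul_assoc _ (pairEmb d _ x),
        doubleBraid_mul_pairEmb]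
      simp only [mul_assoc]
      rw [(commute_shiftBy_doubleBraid n y).eq]
    rw [h1, hy (n + 1) _ (mul_mem (initialPairs_mono (by omega) ha)
      (pairEmb_mem_initialPairs n x)), map_mul (shiftBy d n), shiftBy_pairEmb, shiftBy_shiftBy,
      zero_add, add_comm 1 n, mul_assoc]
  exact (Submodule.eq_top_iff'.1 hT y : y ∈ T)

theorem IsBraidInvariant.map_mul_shiftBy (hφ : IsBraidInvariant φ) (y : PF d ℕ) {n m : ℕ}
    (hnm : n ≤ m) {a : PF d ℕ} (ha : a ∈ initialPairs d n) :
    φ (a * shiftBy d m y) = φ (a * shiftBy d n y) := by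
  induction m, hnm using Nat.le_induction with
  | base => rfl
  | succ m hm ih => rw [hφ.map_mul_shiftBy_succ y m a (initialPairs_mono hm ha), ih]

theorem IsBraidInvariant.map_shiftBy (hφ : IsBraidInvariant φ) (n : ℕ) (y : PF d ℕ) :
    φ (shiftBy d n y) = φ y := by
  have := hφ.map_mul_shiftBy y (Nat.zero_le n) (one_mem (initialPairs d 0))
  simpa [shiftBy_zero] using this

/-- Two-block form of spreadability: only the order of the blocks matters. -/
theorem IsBraidInvariant.map_shiftBy_mul_shiftBy (hφ : IsBraidInvariant φ) {n : ℕ} {a : PF d ℕ}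
    (ha : a ∈ initialPairs d n) (y : PF d ℕ) {j k : ℕ} (h : n + j ≤ k) :
    φ (shiftBy d j a * shiftBy d k y) = φ (a * shiftBy d n y) := by
  rw [hφ.map_mul_shiftBy y h (shiftBy_mem_initialPairs ha), ← shiftBy_shiftBy, ← map_mul,
    hφ.map_shiftBy]

theorem shiftBy_gram (hφ : IsBraidInvariant φ) {n : ℕ} {a : PF d ℕ}
    (ha : a ∈ initialPairs d n) (j k : ℕ) (h : j < k) :
    φ (star (shiftBy d (n * j) a) * shiftBy d (n * k) a) = φ (star a * shiftBy d n a) := by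
  rw [← shiftBy_star]
  refine hφ.map_shiftBy_mul_shiftBy (star_mem_initialPairs ha) a ?_
  calc n + n * j = n * (j + 1) := by ring
    _ ≤ n * k := Nat.mul_le_mul_left n h

theorem shiftBy_gram_self (hφ : IsBraidInvariant φ) (a : PF d ℕ) (k : ℕ) :
    (φ (star (shiftBy d k a) * shiftBy d k a)).re = (φ (star a * a)).re := by
  rw [← shiftBy_star, ← map_mul, hφ.map_shiftBy]

theorem norm_map_star_mul_shiftBy_le (hφ : IsBraidInvariant φ) (hp : IsPositive φ) {n : ℕ}
    {a : PF d ℕ} (ha : a ∈ initialPairs d n) :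
    ‖φ (star a * shiftBy d n a)‖ ≤ (φ (star a * shiftBy d n a)).re :=
  norm_le_re_of_gram hp (shiftBy_gram hφ ha) fun _ => shiftBy_gram_self hφ a _

/-- If `a` is orthogonal to its translate, then it is orthogonal to everything beyond it. -/
theorem map_star_mul_shiftBy_eq_zero (hφ : IsBraidInvariant φ) (hp : IsPositive φ) {n : ℕ}
    {a : PF d ℕ} (ha : a ∈ initialPairs d n) (h0 : φ (star a * shiftBy d n a) = 0) (y : PF d ℕ) :
    φ (star a * shiftBy d n y) = 0 := by
  refine eq_zero_of_gram hp (v := fun k => shiftBy d (n * k) a)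
    (fun j k h => (shiftBy_gram hφ ha j k h).trans h0) (fun _ => shiftBy_gram_self hφ a _)
    (fun k => shiftBy d (n * k) y) (fun _ => shiftBy_gram_self hφ y _) fun j k h => ?_
  rw [← shiftBy_star]
  refine hφ.map_shiftBy_mul_shiftBy (star_mem_initialPairs ha) y ?_
  calc n + n * j = n * (j + 1) := by ring
    _ ≤ n * k := Nat.mul_le_mul_left n h

/-- If a unitary `w` picks up a nontrivial phase `s` when moved past its translate `α(w)`, then it
is orthogonal to everything beyond it: both `φ(w* α(w))` and `φ(w α(w)*)` are nonnegative, while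
the conjugate of the first is `s` times the second, so both vanish. -/
theorem map_star_mul_shiftBy_eq_zero_of_comm (hφ : IsBraidInvariant φ) (hp : IsPositive φ) {n : ℕ}
    {w : PF d ℕ} (hw : w ∈ initialPairs d n) (hwu : w ∈ unitary (PF d ℕ)) {s : ℂ} (hs : ‖s‖ = 1)
    (hs1 : s ≠ 1) (hcomm : w * shiftBy d n w = s • (shiftBy d n w * w)) (y : PF d ℕ) :
    φ (star w * shiftBy d n y) = 0 := by
  obtain ⟨h1, h2⟩ := Unitary.mem_iff.1 hwu
  have h1' : star (shiftBy d n w) * shiftBy d n w = 1 := by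
    rw [← shiftBy_star, ← map_mul, h1, map_one]
  have h2' : shiftBy d n w * star (shiftBy d n w) = 1 := by
    rw [← shiftBy_star, ← map_mul, h2, map_one]
  have e : star (shiftBy d n w) * w = s • (w * star (shiftBy d n w)) := by
    calc star (shiftBy d n w) * w
        = star (shiftBy d n w) * (w * shiftBy d n w) * star (shiftBy d n w) := by
          rw [mul_assoc, mul_assoc, h2', mul_one]
      _ = s • (star (shiftBy d n w) * shiftBy d n w * w * star (shiftBy d n w)) := by
          rw [hcomm, mul_smul_comm, smul_mul_assoc]; simp only [mul_assoc]
      _ = _ := by rw [h1', one_mul]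
  refine map_star_mul_shiftBy_eq_zero hφ hp hw ?_ y
  have hC := norm_map_star_mul_shiftBy_le hφ hp hw
  have hD := norm_map_star_mul_shiftBy_le hφ hp (star_mem_initialPairs hw)
  have hCD := congrArg φ e
  rw [hp.map_star_mul w (shiftBy d n w), map_smul, smul_eq_mul] at hCD
  rw [star_star, shiftBy_star] at hD
  set C := φ (star w * shiftBy d n w)
  set D := φ (w * star (shiftBy d n w))
  -- `C̄ = s D` with `C` and `D` equal to their norms, which agree because `‖s‖ = 1`.
  have real_of : ∀ z : ℂ, ‖z‖ ≤ z.re → z = (‖z‖ : ℂ) := by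
    intro z hz
    have h3 := le_antisymm hz (Complex.re_le_norm z)
    have h4 := Complex.sq_norm z
    rw [Complex.normSq_apply, h3] at h4
    refine Complex.ext (by simp [h3]) ?_
    rw [Complex.ofReal_im]
    nlinarith
  have hn : ‖C‖ = ‖D‖ := by
    have := congrArg norm hCD
    rwa [RCLike.norm_conj, norm_mul, hs, one_mul] at this
  rw [real_of C hC, real_of D hD, ← hn, Complex.conj_ofReal] at hCD
  by_contra hne
  refine hs1 (mul_right_cancel₀ (b := (‖C‖ : ℂ)) ?_ (by rw [← hCD, one_mul]))
  simpa using hne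

theorem map_star_word_mul_shiftBy_eq_zero (hφ : IsBraidInvariant φ) (hp : IsPositive φ)
    {l : List ℕ} (hl : ¬ d ∣ l.length * l.length) {n : ℕ} (hn : ∀ i ∈ l, i < 2 * n)
    (y : PF d ℕ) : φ (star (word d l) * shiftBy d n y) = 0 :=
  map_star_mul_shiftBy_eq_zero_of_comm hφ hp (word_mem_initialPairs hn) (word_mem_unitary l)
    (by rw [norm_pow, norm_q, one_pow])
    (fun h => hl ((q_isPrimitiveRoot d).pow_eq_one_iff_dvd _ |>.1 h))
    (word_mul_shiftBy_word hn l) y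

theorem map_word_eq_zero (hφ : IsBraidInvariant φ) (hp : IsPositive φ)
    {l : List ℕ} (hl : ¬ d ∣ l.length * l.length) : φ (word d l) = 0 := by
  obtain ⟨n, hn⟩ := exists_lt_two_mul l
  have := map_star_word_mul_shiftBy_eq_zero hφ hp hl hn 1
  rw [map_one, mul_one, hp.map_star] at this
  simpa using this

end Spread

/-! ### Product states and extreme points -/

section Product

variable {d : ℕ} [NeZero d] {φ : PF d ℕ →ₗ[ℂ] ℂ} {ρ : PF d (Fin 2) →ₗ[ℂ] ℂ}

theorem mem_braidInvariantStates_iff :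
    φ ∈ braidInvariantStates d ↔ IsState φ ∧ IsBraidInvariant φ :=
  and_congr_right fun _ => isBraidInvariant_iff.symm

omit [NeZero d] in
theorem prod_range_pairEmb_succ (n : ℕ) (x : ℕ → PF d (Fin 2)) :
    ((List.range (n + 1)).map fun k => pairEmb d k (x k)).prod =
      pairEmb d 0 (x 0) *
        shiftBy d 1 ((List.range n).map fun k => pairEmb d k (x (k + 1))).prod := by
  rw [List.range_succ_eq_map, List.map_cons, List.prod_cons, List.map_map, map_list_prod,
    List.map_map]
  congr 3
  funext k
  simp [shiftBy_pairEmb]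

/-- The product property can be tested by splitting off the pair `0`. -/
theorem isProductState_iff : IsProductState φ ρ ↔
    φ 1 = 1 ∧ ∀ x y, φ (pairEmb d 0 x * shiftBy d 1 y) = ρ x * φ y := by
  constructor
  · intro h
    refine ⟨by simpa using h 0 0, ?_⟩
    -- It suffices to treat ordered products `y`, since these span the algebra.
    let W : Submodule ℂ (PF d ℕ) := Submodule.span ℂ
      {y | ∃ (n : ℕ) (x : ℕ → PF d (Fin 2)), y =
        ((List.range n).map fun k => pairEmb d k (x k)).prod}
    have hmem : ∀ (x₀ : PF d (Fin 2)) (n : ℕ) (x : ℕ → PF d (Fin 2)),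
        pairEmb d 0 x₀ * shiftBy d 1 ((List.range n).map fun k => pairEmb d k (x k)).prod =
          ((List.range (n + 1)).map fun k =>
            pairEmb d k (if k = 0 then x₀ else x (k - 1))).prod := by
      intro x₀ n x
      rw [prod_range_pairEmb_succ n fun k => if k = 0 then x₀ else x (k - 1)]
      simp
    have hW : W = ⊤ := by
      refine eq_top_of_pairEmb_mul_shiftBy_mem W
        (Submodule.subset_span ⟨0, 0, by simp⟩) fun x₀ y hy => ?_
      induction hy using Submodule.span_induction with
      | mem y hy =>
        obtain ⟨n, x, rfl⟩ := hy
        exact Submodule.subset_span ⟨n + 1, _, hmem x₀ n x⟩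
      | zero => simp
      | add y z _ _ hy hz => rw [map_add, mul_add]; exact W.add_mem hy hz
      | smul r y _ hy => rw [map_smul, mul_smul_comm]; exact W.smul_mem _ hy
    intro x₀ y
    have hy : y ∈ W := hW ▸ Submodule.mem_top
    induction hy using Submodule.span_induction with
    | mem y hy =>
      obtain ⟨n, x, rfl⟩ := hy
      rw [hmem, h, h, Finset.prod_range_succ']
      simp [mul_comm]
    | zero => simp
    | add y z _ _ hy hz => rw [map_add, mul_add, map_add, hy, hz, map_add, mul_add]
    | smul r y _ hy =>
      rw [map_smul, mul_smul_comm, map_smul, hy, map_smul, smul_eq_mul, smul_eq_mul]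
      ring
  · rintro ⟨h1, h⟩ n
    induction n with
    | zero => intro x; simpa using h1
    | succ n ih =>
      intro x
      rw [prod_range_pairEmb_succ, h, ih fun k => x (k + 1), Finset.prod_range_succ', mul_comm]

theorem IsProductState.eq {ψ : PF d ℕ →ₗ[ℂ] ℂ} (hφ : IsProductState φ ρ)
    (hψ : IsProductState ψ ρ) : ψ = φ := by
  rw [isProductState_iff] at hφ hψ
  have : LinearMap.eqLocus ψ φ = ⊤ := by
    refine eq_top_of_pairEmb_mul_shiftBy_mem _ ?_ fun x y hy => ?_
    · rw [LinearMap.mem_eqLocus, hφ.1, hψ.1]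
    · rw [LinearMap.mem_eqLocus] at hy ⊢
      rw [hφ.2, hψ.2, hy]
  exact LinearMap.eqLocus_eq_top.1 this

/-- For a product state, the centred elements of a pair are uncorrelated with their translates. This
property passes to both components of a convex decomposition, because the correlations there are
nonnegative; and then spreadability turns it into the product property. -/
theorem IsProductState.mem_extremePoints (hρ : IsState ρ) (h : IsProductState φ ρ)
    (hφ : φ ∈ braidInvariantStates d) :
    φ ∈ Set.extremePoints ℝ (braidInvariantStates d) := by
  refine ⟨hφ, fun ψ hψ χ hχ hseg => h.eq ?_⟩
  obtain ⟨hψs, hψi⟩ := mem_braidInvariantStates_iff.1 hψ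
  obtain ⟨hχs, hχi⟩ := mem_braidInvariantStates_iff.1 hχ
  obtain ⟨s, t, hs, ht, hst, rfl⟩ := hseg
  refine isProductState_iff.2 ⟨hψs.1, fun x y => ?_⟩
  obtain ⟨h1, h2⟩ := isProductState_iff.1 h
  let v : PF d (Fin 2) := star x - ρ (star x) • 1
  have hρv : ρ v = 0 := by simp [v, hρ.1]
  have hsv : star v = x - ρ x • 1 := by
    simp [v, hρ.isPositive.map_star]
  have hv : pairEmb d 0 v ∈ initialPairs d 1 := pairEmb_mem_initialPairs 0 v
  have h0 := h2 (star v) (pairEmb d 0 v)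
  have h3 := h2 v 1
  simp only [map_one, mul_one, hρv, zero_mul] at h3
  rw [h3, mul_zero, pairEmb_star, LinearMap.add_apply, LinearMap.smul_apply,
    LinearMap.smul_apply] at h0
  have hC := norm_map_star_mul_shiftBy_le hψi hψs.isPositive hv
  have hC' := norm_map_star_mul_shiftBy_le hχi hχs.isPositive hv
  -- The correlations of both components are nonnegative and their convex combination vanishes.
  have h4 : ψ (star (pairEmb d 0 v) * shiftBy d 1 (pairEmb d 0 v)) = 0 := by
    rw [← norm_eq_zero]
    have := congrArg Complex.re h0
    simp only [Complex.add_re, Complex.smul_re, smul_eq_mul, Complex.zero_re] at this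
    refine le_antisymm ?_ (norm_nonneg _)
    refine le_of_mul_le_mul_left ?_ hs
    have e1 := mul_le_mul_of_nonneg_left hC hs.le
    have e2 := mul_nonneg ht.le ((norm_nonneg _).trans hC')
    linarith
  have h5 := map_star_mul_shiftBy_eq_zero hψi hψs.isPositive hv h4 y
  rw [← pairEmb_star, hsv, map_sub, map_smul, map_one, sub_mul, smul_mul_assoc, one_mul, map_sub,
    map_smul, hψi.map_shiftBy, sub_eq_zero] at h5
  exact h5

/-- A positive invariant functional dominated by an extreme invariant state is a multiple of it. -/
theorem eq_smul_of_mem_extremePoints (hφ : φ ∈ Set.extremePoints ℝ (braidInvariantStates d))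
    {ψ χ : PF d ℕ →ₗ[ℂ] ℂ} (hψ : IsPositive ψ) (hχ : IsPositive χ) (hψi : IsBraidInvariant ψ)
    (hχi : IsBraidInvariant χ) (h : ψ + χ = φ) : ψ = ψ 1 • φ := by
  have real_one : ∀ {ξ : PF d ℕ →ₗ[ℂ] ℂ}, IsPositive ξ → 0 ≤ (ξ 1).re ∧ ξ 1 = ((ξ 1).re : ℂ) := by
    intro ξ hξ
    have := hξ 1
    rw [star_one, one_mul] at this
    exact ⟨this.1, Complex.ext rfl this.2⟩
  have hstate : ∀ {ξ : PF d ℕ →ₗ[ℂ] ℂ}, IsPositive ξ → IsBraidInvariant ξ → 0 < (ξ 1).re →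
      (ξ 1).re⁻¹ • ξ ∈ braidInvariantStates d := by
    intro ξ hξ hξi h0
    refine mem_braidInvariantStates_iff.2 ⟨⟨?_, fun x => ?_⟩, fun j x => ?_⟩
    · rw [LinearMap.smul_apply, (real_one hξ).2, Complex.real_smul, Complex.ofReal_re,
        ← Complex.ofReal_mul, inv_mul_cancel₀ h0.ne', Complex.ofReal_one]
    · rw [LinearMap.smul_apply, Complex.smul_re, Complex.smul_im, (hξ x).2, smul_zero]
      exact ⟨mul_nonneg (inv_nonneg.2 h0.le) (hξ x).1, rfl⟩
    · rw [LinearMap.smul_apply, LinearMap.smul_apply, hξi]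
  obtain ⟨hψ0, hψ1⟩ := real_one hψ
  obtain ⟨hχ0, hχ1⟩ := real_one hχ
  have hsum : (ψ 1).re + (χ 1).re = 1 := by
    rw [← Complex.add_re, ← LinearMap.add_apply, h, (mem_braidInvariantStates_iff.1 hφ.1).1.1,
      Complex.one_re]
  -- If one of the two components vanishes at `1`, it is zero; otherwise both can be normalised.
  rcases hψ0.eq_or_lt with h0 | h0
  · have : ψ = 0 := hψ.eq_zero_of_map_one (by rw [hψ1, ← h0, Complex.ofReal_zero])
    rw [this, LinearMap.zero_apply, zero_smul]
  rcases hχ0.eq_or_lt with h0' | h0'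
  · have : χ = 0 := hχ.eq_zero_of_map_one (by rw [hχ1, ← h0', Complex.ofReal_zero])
    rw [this, add_zero] at h
    rw [h, (mem_braidInvariantStates_iff.1 hφ.1).1.1, one_smul]
  have key := hφ.2 (hstate hψ hψi h0) (hstate hχ hχi h0')
    ⟨(ψ 1).re, (χ 1).re, h0, h0', hsum, by
      rw [smul_smul, smul_smul, mul_inv_cancel₀ h0.ne', mul_inv_cancel₀ h0'.ne', one_smul,
        one_smul, h]⟩
  ext x
  rw [← key, LinearMap.smul_apply, LinearMap.smul_apply, hψ1, Complex.ofReal_re, smul_eq_mul,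
    Complex.real_smul, ← mul_assoc, ← Complex.ofReal_mul, mul_inv_cancel₀ h0.ne',
    Complex.ofReal_one, one_mul]

/-- The functional `y ↦ φ(Z* α(y) Z)`, where `α` is the shift by one pair and `Z` is the image of
`z` in the algebra of the pair `0`. -/
def conjShift (φ : PF d ℕ →ₗ[ℂ] ℂ) (z : PF d (Fin 2)) : PF d ℕ →ₗ[ℂ] ℂ :=
  φ ∘ₗ LinearMap.mulLeft ℂ (star (pairEmb d 0 z)) ∘ₗ LinearMap.mulRight ℂ (pairEmb d 0 z) ∘ₗ
    (shiftBy d 1).toLinearMap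

theorem conjShift_apply (z : PF d (Fin 2)) (y : PF d ℕ) :
    conjShift φ z y = φ (star (pairEmb d 0 z) * (shiftBy d 1 y * pairEmb d 0 z)) := rfl

theorem IsPositive.conjShift (hφ : IsPositive φ) (z : PF d (Fin 2)) :
    IsPositive (conjShift φ z) := by
  intro x
  have e : star (pairEmb d 0 z) * (shiftBy d 1 (star x * x) * pairEmb d 0 z) =
      star (shiftBy d 1 x * pairEmb d 0 z) * (shiftBy d 1 x * pairEmb d 0 z) := by
    rw [map_mul, shiftBy_star, star_mul]
    simp only [mul_assoc]
  rw [conjShift_apply, e]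
  exact hφ _

theorem IsBraidInvariant.conjShift (hφ : IsBraidInvariant φ) (z : PF d (Fin 2)) :
    IsBraidInvariant (conjShift φ z) := by
  intro j x
  have h1 := (commute_pairEmb_zero_doubleBraid_succ j (star z)).eq
  have h2 := (commute_pairEmb_zero_doubleBraid_succ j (star z)).star_star.eq
  rw [pairEmb_star] at h1
  rw [pairEmb_star, star_star] at h2
  rw [conjShift_apply, conjShift_apply,
    ← hφ (j + 1) (star (pairEmb d 0 z) * (shiftBy d 1 x * pairEmb d 0 z))]
  congr 1
  rw [map_mul, map_mul, shiftBy_star, shiftBy_doubleBraid]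
  simp only [mul_assoc]
  rw [h2, ← mul_assoc, h1, mul_assoc]

omit [NeZero d] in
theorem pairEmb_zero_word (l : List (Fin 2)) :
    pairEmb d 0 (word d l) = word d (l.map fun i => i.val) :=
  map_word (fun i => by simp) l

theorem leastRoot_spec (d : ℕ) [NeZero d] : 0 < leastRoot d ∧ d ∣ leastRoot d ^ 2 :=
  Nat.sInf_mem (s := {n : ℕ | 0 < n ∧ d ∣ n ^ 2})
    ⟨d, Nat.pos_of_ne_zero (NeZero.ne d), dvd_pow_self d two_ne_zero⟩

/-- The least root divides every root: `d` divides `gcd(a, p₀)²`, so `gcd(a, p₀)` is not smaller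
than `p₀`. -/
theorem leastRoot_dvd {a : ℕ} (h : d ∣ a * a) : leastRoot d ∣ a := by
  obtain ⟨h1, h2⟩ := leastRoot_spec d
  have h3 : d ∣ (Nat.gcd a (leastRoot d)) ^ 2 := by
    rw [← Nat.pow_gcd_pow]
    exact Nat.dvd_gcd (by rwa [sq]) h2
  have h4 : leastRoot d ≤ Nat.gcd a (leastRoot d) :=
    Nat.sInf_le ⟨Nat.gcd_pos_of_pos_right _ h1, h3⟩
  rw [← Nat.gcd_eq_right_iff_dvd]
  exact le_antisymm (Nat.gcd_le_right _ h1) h4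

theorem dvd_mul_of_dvd_mul_self {a b : ℕ} (ha : d ∣ a * a) (hb : d ∣ b * b) : d ∣ a * b :=
  (leastRoot_spec d).2.trans (sq (leastRoot d) ▸ mul_dvd_mul (leastRoot_dvd ha) (leastRoot_dvd hb))

/-- Conjugation by a word of charge `a` with `d ∣ a²` on the pair `0` does not change a
braid-invariant state on the later pairs: on an element of charge `b` it gives the phase `q^{±ab}`,
and if this is not `1` then the state vanishes there. -/
theorem map_star_mul_shiftBy_mul (hφ : IsBraidInvariant φ) (hp : IsPositive φ) {l : List (Fin 2)}
    (hl : d ∣ l.length * l.length) (y : PF d ℕ) :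
    φ (star (pairEmb d 0 (word d l)) * (shiftBy d 1 y * pairEmb d 0 (word d l))) = φ y := by
  have : LinearMap.eqLocus (conjShift φ (word d l)) φ = ⊤ := by
    refine eq_top_of_word_mem _ fun l' => ?_
    rw [LinearMap.mem_eqLocus, conjShift_apply, pairEmb_zero_word]
    set U := word d (l.map fun i => i.val)
    have h1 : U * shiftBy d 1 (word d l') =
        q d ^ (l.length * l'.length) • (shiftBy d 1 (word d l') * U) := by
      rw [word_mul_shiftBy_word (fun i hi => ?_), List.length_map]
      obtain ⟨k, -, rfl⟩ := List.mem_map.1 hi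
      omega
    have h2 : star U * U = 1 := (Unitary.mem_iff.1 (word_mem_unitary _)).1
    have h3 : φ (word d l') =
        q d ^ (l.length * l'.length) * φ (star U * (shiftBy d 1 (word d l') * U)) := by
      rw [← smul_eq_mul, ← map_smul, ← mul_smul_comm, ← h1, ← mul_assoc, h2, one_mul,
        hφ.map_shiftBy]
    by_cases hl' : d ∣ l'.length * l'.length
    · rw [h3, ((q_isPrimitiveRoot d).pow_eq_one_iff_dvd _).2 (dvd_mul_of_dvd_mul_self hl hl'),
        one_mul]
    · rw [map_word_eq_zero hφ hp hl'] at h3 ⊢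
      exact (mul_eq_zero.1 h3.symm).resolve_left (pow_ne_zero _ (q_ne_zero d))
  exact LinearMap.congr_fun (LinearMap.eqLocus_eq_top.1 this) y

/-- The factorisation for the adjoint of a word `u`. If `u` has charge `a` with `d ∣ a²`, the
elements `z = (1 + λu)/2` and `(1 - λu)/2` with `|λ| = 1` decompose the extreme state into two
positive invariant functionals, so both are multiples of it. For the other charges both sides
vanish. -/
theorem map_star_word_mul_shiftBy (hφ : φ ∈ Set.extremePoints ℝ (braidInvariantStates d))
    (l : List (Fin 2)) (y : PF d ℕ) :
    φ (star (pairEmb d 0 (word d l)) * shiftBy d 1 y) =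
      φ (star (pairEmb d 0 (word d l))) * φ y := by
  obtain ⟨hs, hi⟩ := mem_braidInvariantStates_iff.1 hφ.1
  have hp := hs.isPositive
  by_cases hl : d ∣ l.length * l.length
  · have hconj : ∀ y, φ (star (pairEmb d 0 (word d l)) *
        (shiftBy d 1 y * pairEmb d 0 (word d l))) = φ y := map_star_mul_shiftBy_mul hi hp hl
    set U := pairEmb d 0 (word d l) with hU
    have expand : ∀ t : ℂ, starRingEnd ℂ t * t = 1 → ∀ y,
        conjShift φ ((2 : ℂ)⁻¹ • (1 + t • word d l)) y =
          4⁻¹ * (2 * φ y + t * φ (shiftBy d 1 y * U) +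
            starRingEnd ℂ t * φ (star U * shiftBy d 1 y)) := by
      intro t ht y
      rw [conjShift_apply, map_smul, map_add, map_one, map_smul, ← hU]
      simp only [star_smul, star_add, star_one, add_mul, mul_add, one_mul, mul_one,
        smul_mul_assoc, mul_smul_comm, map_smul, map_add, smul_eq_mul, hconj, hi.map_shiftBy,
        smul_add, RCLike.star_def, map_inv₀, map_ofNat]
      linear_combination (4⁻¹ * φ y) * ht
    have key : ∀ t : ℂ, starRingEnd ℂ t * t = 1 → t * φ (shiftBy d 1 y * U) +
        starRingEnd ℂ t * φ (star U * shiftBy d 1 y) =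
          (t * φ U + starRingEnd ℂ t * φ (star U)) * φ y := by
      intro t ht
      have ht' : starRingEnd ℂ (-t) * (-t) = 1 := by rw [map_neg, neg_mul_neg, ht]
      have h1 := eq_smul_of_mem_extremePoints hφ
        (hp.conjShift ((2 : ℂ)⁻¹ • (1 + t • word d l)))
        (hp.conjShift ((2 : ℂ)⁻¹ • (1 + (-t) • word d l)))
        (hi.conjShift _) (hi.conjShift _) (by
          ext y
          rw [LinearMap.add_apply, expand t ht, expand _ ht', map_neg]
          ring)
      have h2 := LinearMap.congr_fun h1 y
      rw [LinearMap.smul_apply, expand t ht, expand t ht, map_one (shiftBy d 1), one_mul, mul_one,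
        hs.1, smul_eq_mul] at h2
      linear_combination 4 * h2
    -- The case `λ = 1` plus `i` times the case `λ = i` isolates the terms with `U*`.
    have k1 := key 1 (by simp)
    have k2 := key Complex.I (by simp)
    rw [map_one] at k1
    rw [Complex.conj_I] at k2
    linear_combination (1 / 2 : ℂ) * k1 + (Complex.I / 2) * k2 +
      (1 / 2 : ℂ) * (φ (star U * shiftBy d 1 y) - φ (star U) * φ y + φ U * φ y
        - φ (shiftBy d 1 y * U)) * Complex.I_sq
  · have h0 : ∀ y, φ (star (pairEmb d 0 (word d l)) * shiftBy d 1 y) = 0 := by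
      intro y
      rw [pairEmb_zero_word]
      refine map_star_word_mul_shiftBy_eq_zero hi hp (by rwa [List.length_map]) (fun i h => ?_) y
      obtain ⟨k, -, rfl⟩ := List.mem_map.1 h
      omega
    have h1 := h0 1
    rw [map_one, mul_one] at h1
    rw [h0, h1, zero_mul]

theorem isState_comp_pairEmb (hφ : IsState φ) :
    IsState (φ ∘ₗ (pairEmb d 0).toLinearMap) := by
  refine ⟨by simp [hφ.1], fun x => ?_⟩
  have := hφ.2 (pairEmb d 0 x)
  rwa [← pairEmb_star, ← map_mul] at this

theorem isProductState_of_mem_extremePoints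
    (hφ : φ ∈ Set.extremePoints ℝ (braidInvariantStates d)) :
    IsProductState φ (φ ∘ₗ (pairEmb d 0).toLinearMap) := by
  obtain ⟨hs, hi⟩ := mem_braidInvariantStates_iff.1 hφ.1
  refine isProductState_iff.2 ⟨hs.1, fun x y => ?_⟩
  let T : Submodule ℂ (PF d (Fin 2)) :=
    { carrier := {x | φ (star (pairEmb d 0 x) * shiftBy d 1 y) = φ (star (pairEmb d 0 x)) * φ y}
      add_mem' := fun {a b} ha hb => by
        have ha' : φ _ = _ := ha
        have hb' : φ _ = _ := hb
        change φ _ = _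
        rw [map_add, star_add, add_mul, map_add, map_add, ha', hb', add_mul]
      zero_mem' := by simp
      smul_mem' := fun r a ha => by
        have ha' : φ _ = _ := ha
        change φ _ = _
        rw [map_smul, star_smul, smul_mul_assoc, map_smul, map_smul, ha', smul_eq_mul,
          smul_eq_mul, mul_assoc] }
  have hT : T = ⊤ := eq_top_of_word_mem T fun l => map_star_word_mul_shiftBy hφ l y
  have hx : φ (star (pairEmb d 0 (star x)) * shiftBy d 1 y) =
      φ (star (pairEmb d 0 (star x))) * φ y := (Submodule.eq_top_iff'.1 hT (star x) : star x ∈ T)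
  rwa [pairEmb_star, star_star] at hx

end Product

/-! ### The density matrix -/

section Density

variable {d : ℕ} [NeZero d]

theorem q_pow_eq_stdAddChar (n : ℕ) : q d ^ n = ZMod.stdAddChar (n : ZMod d) := by
  have : (n : ZMod d) = ((n : ℤ) : ZMod d) := by simp
  rw [this, ZMod.stdAddChar_coe, q, ← Complex.exp_nat_mul]
  congr 1
  push_cast
  ring

theorem shift_pow_apply (n : ℕ) (i j : ZMod d) :
    (shift d ^ n) i j = if i = j + (n : ZMod d) then 1 else 0 := by
  induction n generalizing i j with
  | zero => simp [Matrix.one_apply]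
  | succ n ih =>
    rw [pow_succ, Matrix.mul_apply]
    simp only [ih]
    simp [shift, add_assoc, add_comm (1 : ZMod d)]

theorem trace_clock_pow_mul_shift_pow (m n : ℕ) :
    Matrix.trace (clock d ^ m * shift d ^ n) =
      if (m : ZMod d) = 0 ∧ (n : ZMod d) = 0 then (d : ℂ) else 0 := by
  have h : ∀ i : ZMod d, (clock d ^ m * shift d ^ n) i i =
      ZMod.stdAddChar (i * (m : ZMod d)) * if (n : ZMod d) = 0 then 1 else 0 := by
    intro i
    rw [clock, Matrix.diagonal_pow, Matrix.diagonal_mul, shift_pow_apply, Pi.pow_apply, ← pow_mul,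
      q_pow_eq_stdAddChar]
    simp
  simp only [Matrix.trace, Matrix.diag_apply, h]
  rw [← Finset.sum_mul, AddChar.sum_mulShift _ (ZMod.isPrimitive_stdAddChar d), ZMod.card]
  split_ifs <;> simp_all

theorem toMatrix_c_zero : toMatrix d (c 0) = clock d := lift_c _ _ _ _

theorem toMatrix_c_one : toMatrix d (c 1) = shift d := lift_c _ _ _ _

omit [NeZero d] in
theorem eq_top_of_c_one_pow_mul_c_zero_pow_mem (T : Submodule ℂ (PF d (Fin 2)))
    (h : ∀ k l : ℕ, c 1 ^ k * c 0 ^ l ∈ T) : T = ⊤ := by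
  have : Submodule.span ℂ {x : PF d (Fin 2) | ∃ k l : ℕ, x = c 1 ^ k * c 0 ^ l} = ⊤ := by
    refine eq_top_of_c_mul_mem _ (Submodule.subset_span ⟨0, 0, by simp⟩) fun i y hy => ?_
    induction hy using Submodule.span_induction with
    | mem x hx =>
      obtain ⟨k, l, rfl⟩ := hx
      fin_cases i
      · have e : (c 0 * c 1 ^ k : PF d (Fin 2)) = q d ^ k • (c 1 ^ k * c 0) := by
          simpa using pow_comm_aux (c_comm (d := d) (show (0 : Fin 2) < 1 by decide)) 1 k
        change c 0 * (c 1 ^ k * c 0 ^ l) ∈ _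
        rw [← mul_assoc, e, smul_mul_assoc, mul_assoc, ← pow_succ']
        exact Submodule.smul_mem _ _ (Submodule.subset_span ⟨k, l + 1, rfl⟩)
      · change c 1 * (c 1 ^ k * c 0 ^ l) ∈ _
        rw [← mul_assoc, ← pow_succ']
        exact Submodule.subset_span ⟨k + 1, l, rfl⟩
    | zero => simp
    | add x y _ _ hx hy => rw [mul_add]; exact Submodule.add_mem _ hx hy
    | smul a x _ hx => rw [mul_smul_comm]; exact Submodule.smul_mem _ _ hx
  rw [eq_top_iff, ← this, Submodule.span_le]
  rintro _ ⟨k, l, rfl⟩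
  exact h k l

/-- The density matrix of a functional on `PF_2`, in the basis `c₀ⁱ c₁ʲ`, which is orthogonal for
the trace. -/
def densityMatrix (ρ : PF d (Fin 2) →ₗ[ℂ] ℂ) : PF d (Fin 2) :=
  (d : ℂ)⁻¹ • ∑ p : ZMod d × ZMod d,
    ρ (c 1 ^ (-p.2).val * c 0 ^ (-p.1).val) • (c 0 ^ p.1.val * c 1 ^ p.2.val)

theorem isDensityMatrix_densityMatrix (ρ : PF d (Fin 2) →ₗ[ℂ] ℂ) :
    IsDensityMatrix (densityMatrix ρ) ρ := by
  have hd : (d : ℂ) ≠ 0 := Nat.cast_ne_zero.2 (NeZero.ne d)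
  let τ : PF d (Fin 2) →ₗ[ℂ] ℂ := Matrix.traceLinearMap (ZMod d) ℂ ℂ ∘ₗ
    LinearMap.mulLeft ℂ (toMatrix d (densityMatrix ρ)) ∘ₗ (toMatrix d).toLinearMap
  have : LinearMap.eqLocus ρ τ = ⊤ := by
    refine eq_top_of_c_one_pow_mul_c_zero_pow_mem _ fun k l => ?_
    rw [LinearMap.mem_eqLocus]
    have h1 : ∀ p : ZMod d × ZMod d, Matrix.trace
        (toMatrix d (c 0 ^ p.1.val * c 1 ^ p.2.val) * toMatrix d (c 1 ^ k * c 0 ^ l)) =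
          if p = (-(l : ZMod d), -(k : ZMod d)) then (d : ℂ) else 0 := by
      intro p
      simp only [map_mul, map_pow, toMatrix_c_zero, toMatrix_c_one]
      rw [← mul_assoc, Matrix.trace_mul_comm, mul_assoc (clock d ^ _), ← pow_add, ← mul_assoc,
        ← pow_add, trace_clock_pow_mul_shift_pow]
      simp only [Nat.cast_add, ZMod.natCast_val, ZMod.cast_id', id_eq, Prod.ext_iff,
        eq_neg_iff_add_eq_zero, add_comm (l : ZMod d)]
    have h2 : ∀ (i : Fin 2) (n : ℕ), (c i ^ (n : ZMod d).val : PF d (Fin 2)) = c i ^ n := by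
      intro i n
      conv_rhs => rw [← Nat.mod_add_div n d, pow_add, pow_mul, c_pow, one_pow, mul_one]
      rw [ZMod.val_natCast]
    change _ = Matrix.trace (toMatrix d (densityMatrix ρ) * toMatrix d (c 1 ^ k * c 0 ^ l))
    rw [densityMatrix, map_smul, map_sum, smul_mul_assoc, Finset.sum_mul, Matrix.trace_smul,
      Matrix.trace_sum]
    simp only [map_smul, smul_mul_assoc, Matrix.trace_smul, h1]
    simp only [smul_eq_mul, mul_ite, mul_zero, Finset.sum_ite_eq', Finset.mem_univ, if_true,
      neg_neg, h2]
    field_simp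
  intro x
  exact LinearMap.congr_fun (LinearMap.eqLocus_eq_top.1 this) x

/-- The coefficients of the density matrix are values at words. If such a value at a word of
length `a` is nonzero then `d ∣ a²`, so `p₀ ∣ a`, and the corresponding basis element has charge
`-a`. -/
theorem densityMatrix_mem_rootChargePart {ρ : PF d (Fin 2) →ₗ[ℂ] ℂ}
    (h : ∀ l : List (Fin 2), ¬ d ∣ l.length * l.length → ρ (word d l) = 0) :
    densityMatrix ρ ∈ rootChargePart d := by
  refine Submodule.smul_mem _ _ (Submodule.sum_mem _ fun p _ => ?_)
  have hw : ∀ (i j : Fin 2) (m n : ℕ), (c i ^ m * c j ^ n : PF d (Fin 2)) =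
      word d (List.replicate m i ++ List.replicate n j) := by
    intro i j m n
    simp [word]
  by_cases hp : d ∣ ((-p.2).val + (-p.1).val) * ((-p.2).val + (-p.1).val)
  · refine Submodule.smul_mem _ _ ?_
    have hmem : p.1 + p.2 ∈ AddSubgroup.zmultiples ((leastRoot d : ℕ) : ZMod d) := by
      obtain ⟨k, hk⟩ := leastRoot_dvd hp
      have hk' := congrArg (Nat.cast : ℕ → ZMod d) hk
      simp only [Nat.cast_add, Nat.cast_mul, ZMod.natCast_val, ZMod.cast_id', id_eq] at hk'
      refine AddSubgroup.mem_zmultiples_iff.2 ⟨-k, ?_⟩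
      rw [zsmul_eq_mul]
      push_cast
      linear_combination hk'
    refine Submodule.mem_iSup_of_mem (p.1 + p.2) (Submodule.mem_iSup_of_mem hmem ?_)
    refine Submodule.subset_span ⟨_, ?_, hw _ _ _ _⟩
    simp
  · rw [hw, h _ (by simpa using hp), zero_smul]
    exact Submodule.zero_mem _

end Density

end Parafermion

end

theorem mainTheorem1 (d : ℕ) [NeZero d] (φ : Parafermion.PF d ℕ →ₗ[ℂ] ℂ)
    (hφ : φ ∈ Parafermion.braidInvariantStates d) :
    (φ ∈ Set.extremePoints ℝ (Parafermion.braidInvariantStates d) ↔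
      ∃ ρ : Parafermion.PF d (Fin 2) →ₗ[ℂ] ℂ, Parafermion.IsState ρ ∧
        (∃ D ∈ Parafermion.rootChargePart d, Parafermion.IsDensityMatrix D ρ) ∧
        Parafermion.IsProductState φ ρ) ∧
    (φ ∈ Set.extremePoints ℝ (Parafermion.braidInvariantStates d) ↔
      ∃ ρ : Parafermion.PF d (Fin 2) →ₗ[ℂ] ℂ, Parafermion.IsState ρ ∧
        Parafermion.IsProductState φ ρ) := by
  open Parafermion in
  obtain ⟨hs, hi⟩ := mem_braidInvariantStates_iff.1 hφ
  refine ⟨⟨fun h => ?_, fun ⟨ρ, hρ, _, hprod⟩ => hprod.mem_extremePoints hρ hφ⟩,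
    ⟨fun h => ⟨_, isState_comp_pairEmb hs, isProductState_of_mem_extremePoints h⟩,
      fun ⟨ρ, hρ, hprod⟩ => hprod.mem_extremePoints hρ hφ⟩⟩
  refine ⟨_, isState_comp_pairEmb hs, ⟨_, densityMatrix_mem_rootChargePart fun l hl => ?_,
    isDensityMatrix_densityMatrix _⟩, isProductState_of_mem_extremePoints h⟩
  rw [LinearMap.comp_apply, AlgHom.toLinearMap_apply, pairEmb_zero_word]
  exact map_word_eq_zero hi hs.isPositive (by rwa [List.length_map])
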